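/- Let $s,m\ge 0$ be integers (with $m=n-s$) and use coordinates $(w,z,\zeta)\in\mathbb{C}\oplus\mathbb{C}^s\oplus\mathbb{C}^m=\mathbb{C}^{n+1}$. Consider pairs $(\mathbf{H},\mathbf{S})$ in which $\mathbf{H}$ is a nondegenerate Hermitian $s\times s$ matrix and $\mathbf{S}(\zeta)$ is a symmetric $s\times s$ matrix of functions of $\zeta$ that are holomorphic near $0$, with $\mathbf{S}(0)=0$ and with $\mathbf{S}_{\zeta_1}(0),\dots,\mathbf{S}_{\zeta_m}(0)$ linearly independent over $\mathbb{C}$. The model associated with $(\mathbf{H},\mathbf{S})$ is the germ at $0$ of the real hypersurface $$\operatorname{Re}(w)=z^TH(\zeta,\overline\zeta)\overline z+\operatorname{Re}\big(\overline z^TS(\zeta,\overline\zeta)\overline z\big),$$ where $$H(\zeta,\overline\zeta)=\tfrac12\Big(\mathbf{H}\big(\mathrm{Id}-\overline{\mathbf{S}(\zeta)}\mathbf{H}^T\mathbf{S}(\zeta)\mathbf{H}\big)^{-1}+\big(\mathrm{Id}-\mathbf{H}\overline{\mathbf{S}(\zeta)}\mathbf{H}^T\mathbf{S}(\zeta)\big)^{-1}\mathbf{H}\Big),$$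 $$S(\zeta,\overline\zeta)=\mathbf{H}^T\big(\mathrm{Id}-\mathbf{S}(\zeta)\mathbf{H}\overline{\mathbf{S}(\zeta)}\mathbf{H}^T\big)^{-1}\mathbf{S}(\zeta)\mathbf{H}.$$ **Proposition 1.6.** Let $M_0$ and $\tilde M_0$ be the models associated with two such pairs $(\mathbf{H},\mathbf{S})$ and $(\tilde{\mathbf{H}},\tilde{\mathbf{S}})$ (with the same $s$ and $m$). Then $M_0$ and $\tilde M_0$ are locally equivalent at $0$, i.e. there is a local biholomorphism of $\mathbb{C}^{n+1}$ fixing $0$ that maps the germ of $M_0$ at $0$ onto the germ of $\tilde M_0$ at $0$, if and only if there exist $U\in\mathrm{GL}(s,\mathbb{C})$, a sign $\varepsilon\in\{1,-1\}$ and a local biholomorphism $g$ of $\mathbb{C}^{m}$ fixing $0$ such that $$\tilde{\mathbf{H}}=\varepsilon\,U^T\mathbf{H}\overline U\qquad\text{and}\qquad \tilde{\mathbf{S}}(\zeta)=U^{-1}\,\mathbf{S}(g(\zeta))\,(U^{-1})^T\quad\text{for all }\zeta\text{ near }0.$$ -/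

import Mathlib

open Filter Topology Matrix

namespace CRModel

/-- The ambient space `ℂ ⊕ ℂ^s ⊕ ℂ^m` with coordinates `(w, z, ζ)`, where `m = n - s`. -/
abbrev Ambient (s m : ℕ) : Type := ℂ × (Fin s → ℂ) × (Fin m → ℂ)

/-- Entrywise complex conjugate of a matrix. -/
def conj {s : ℕ} (A : Matrix (Fin s) (Fin s) ℂ) : Matrix (Fin s) (Fin s) ℂ := A.map star

/-- The real hypersurface `Re w = zᵀ H(ζ, ζ̄) z̄ + Re (z̄ᵀ S(ζ, ζ̄) z̄)`. The matrix functions are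
functions of the point `ζ`, not assumed holomorphic. The equation is an equation between complex
numbers, so it contains the condition that `zᵀ H z̄` is real (automatic for Hermitian `H`). -/
def hypersurface {s m : ℕ} (H S : (Fin m → ℂ) → Matrix (Fin s) (Fin s) ℂ) :
    Set (Ambient s m) :=
  {p | (p.1.re : ℂ) = p.2.1 ⬝ᵥ (H p.2.2 *ᵥ star p.2.1)
      + ((star p.2.1 ⬝ᵥ (S p.2.2 *ᵥ star p.2.1)).re : ℂ)}

/-- `½ (𝐇 (1 - 𝐒̄ 𝐇ᵀ 𝐒 𝐇)⁻¹ + (1 - 𝐇 𝐒̄ 𝐇ᵀ 𝐒)⁻¹ 𝐇)`. The matrices that are inverted are invertible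
near `ζ = 0` when `𝐒` is continuous at `0` with `𝐒(0) = 0`. -/
noncomputable def hermitianPart {s m : ℕ} (H : Matrix (Fin s) (Fin s) ℂ)
    (S : (Fin m → ℂ) → Matrix (Fin s) (Fin s) ℂ) (ζ : Fin m → ℂ) : Matrix (Fin s) (Fin s) ℂ :=
  (1 / 2 : ℂ) • (H * (1 - conj (S ζ) * Hᵀ * S ζ * H)⁻¹ + (1 - H * conj (S ζ) * Hᵀ * S ζ)⁻¹ * H)

/-- `𝐇ᵀ (1 - 𝐒 𝐇 𝐒̄ 𝐇ᵀ)⁻¹ 𝐒 𝐇`. -/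
noncomputable def symmetricPart {s m : ℕ} (H : Matrix (Fin s) (Fin s) ℂ)
    (S : (Fin m → ℂ) → Matrix (Fin s) (Fin s) ℂ) (ζ : Fin m → ℂ) : Matrix (Fin s) (Fin s) ℂ :=
  Hᵀ * (1 - S ζ * H * conj (S ζ) * Hᵀ)⁻¹ * S ζ * H

/-- The model associated with the pair `(𝐇, 𝐒)`; only its germ at `0` matters. -/
noncomputable def model {s m : ℕ} (H : Matrix (Fin s) (Fin s) ℂ)
    (S : (Fin m → ℂ) → Matrix (Fin s) (Fin s) ℂ) : Set (Ambient s m) :=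
  hypersurface (hermitianPart H S) (symmetricPart H S)

/-- Admissible pairs: `𝐇` is a nondegenerate Hermitian matrix and `𝐒` is a symmetric matrix of
functions of `ζ` that are holomorphic near `0` and vanish at `0`, such that the matrices
`∂𝐒/∂ζ_α (0)` are linearly independent over `ℂ`. -/
structure IsModelData {s m : ℕ} (H : Matrix (Fin s) (Fin s) ℂ)
    (S : (Fin m → ℂ) → Matrix (Fin s) (Fin s) ℂ) : Prop where
  isHermitian : H.IsHermitian
  nondegenerate : IsUnit H
  holomorphic : ∀ i j, AnalyticAt ℂ (fun ζ => S ζ i j) 0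
  symmetric : ∀ᶠ ζ in 𝓝 (0 : Fin m → ℂ), (S ζ).IsSymm
  vanishing : S 0 = 0
  independent : LinearIndependent ℂ fun α : Fin m =>
    (Matrix.of fun i j => fderiv ℂ (fun ζ => S ζ i j) 0 (Pi.single α 1) :
      Matrix (Fin s) (Fin s) ℂ)

/-- `e` is a biholomorphism between two open neighbourhoods of `0` that fixes `0`. -/
structure IsLocalBiholomorphism {E : Type*} [NormedAddCommGroup E] [NormedSpace ℂ E]
    (e : OpenPartialHomeomorph E E) : Prop where
  mem_source : (0 : E) ∈ e.source
  map_zero : e 0 = 0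
  holomorphic : AnalyticOnNhd ℂ e e.source
  holomorphic_symm : AnalyticOnNhd ℂ e.symm e.target

/-- Two subsets are locally equivalent at `0`: a local biholomorphism of the ambient space fixing
`0` maps the germ at `0` of the first onto the germ at `0` of the second. -/
def LocallyEquivalent {E : Type*} [NormedAddCommGroup E] [NormedSpace ℂ E]
    (M M' : Set E) : Prop :=
  ∃ φ : OpenPartialHomeomorph E E, IsLocalBiholomorphism φ ∧ ∀ᶠ p in 𝓝 (0 : E), p ∈ M ↔ φ p ∈ M'

end CRModel

/-! For the forward direction, let `φ` be the equivalence with inverse `ψ`. The conjugated variables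
are treated as independent: a holomorphic function vanishing on all pairs `(p, star p)` vanishes, so
`(p, q) ↦ (φ p, star (φ (star q)))` preserves the complexified equations `p.1 + q.1 = 2 * polar H S
p q` (`IsGermMap.polarize`). Only `q` near `0` matters. When the `ζ`-component of `q` is `0`, `S 0 =
0` removes all inverses and `polar` becomes `zᵀ H ξ + ½ ξᵀ Hᵀ S(ζ) H ξ`.

Taking `q = 0`, `φ` preserves `{w = 0}`. Comparing tangent directions of Segre varieties at `0`, it
also preserves the leaf `{w = z = 0}` (`IsGermMap.map_leaf`). Give `z` weight 1 and `w` weight 2.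
The weight-two part along the leaf (`IsGermMap.weight_two`) then involves only first derivatives of
`φ`. With `a = ∂φ_w/∂w (0)` and `B` the `z`-block of `dφ(0)`, it says that `a` is real, `a H = Bᵀ H'
B̄`, and `a Hᵀ S(ζ) H` equals `B̄ᵀ H'ᵀ S'(g(ζ)) H' B̄`, where `g` is `φ` on the leaf. Rescaling `B`
by a square root of `a⁻¹` leaves only the sign of `a`.

Conversely, `(w, z, ζ) ↦ (ε w, c U z, g ζ)` with `c² = ε`, `|c| = 1` carries the second model to the
first, because the matrices of the models transform by congruence. -/

namespace CRModel

/-! ### Uniqueness on the anti-diagonal -/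

/-- A holomorphic function on a disc that vanishes at the real points vanishes. -/
theorem eq_zero_of_real_eq_zero {f : ℂ → ℂ} {R : ℝ} (hf : DifferentiableOn ℂ f (Metric.ball 0 R))
    (h : ∀ t : ℝ, |t| < R → f t = 0) {t : ℂ} (ht : ‖t‖ < R) : f t = 0 := by
  have hR : 0 < R := (norm_nonneg t).trans_lt ht
  have han := hf.analyticOnNhd Metric.isOpen_ball
  have hfr : ∃ᶠ z in 𝓝[≠] (0 : ℂ), f z = 0 := by
    have hev : ∀ᶠ t : ℝ in 𝓝[≠] 0, f (t : ℂ) = 0 := by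
      refine eventually_nhdsWithin_of_eventually_nhds ?_
      filter_upwards [Metric.ball_mem_nhds (0 : ℝ) hR] with t ht
      exact h t (by simpa using ht)
    have htend : Tendsto (fun t : ℝ => (t : ℂ)) (𝓝[≠] 0) (𝓝[≠] 0) := by
      refine tendsto_nhdsWithin_of_tendsto_nhds_of_eventually_within _ ?_ ?_
      · exact (Complex.continuous_ofReal.tendsto' 0 0 (by simp)).mono_left nhdsWithin_le_nhds
      · filter_upwards [self_mem_nhdsWithin] with t ht
        simpa using ht
    exact htend.frequently hev.frequently
  have := han.eqOn_zero_of_preconnected_of_frequently_eq_zero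
    (convex_ball (0 : ℂ) R).isPreconnected (Metric.mem_ball_self hR) hfr
  exact this (by simpa using ht)

/-- The anti-diagonal `{(p, star p)}` is a uniqueness set for holomorphic functions. -/
theorem eventually_eq_zero_of_antidiagonal {A : Type*} [NormedAddCommGroup A] [NormedSpace ℂ A]
    [StarAddMonoid A] [StarModule ℂ A] [ContinuousStar A] {F : A × A → ℂ}
    (hF : ∀ᶠ x in 𝓝 (0 : A × A), DifferentiableAt ℂ F x)
    (h : ∀ᶠ p in 𝓝 (0 : A), F (p, star p) = 0) : ∀ᶠ x in 𝓝 (0 : A × A), F x = 0 := by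
  obtain ⟨r, hr, hFr⟩ := Metric.eventually_nhds_iff_ball.1 hF
  obtain ⟨r', hr', hr0⟩ := Metric.eventually_nhds_iff_ball.1 h
  set δ := min r r' with hδ
  have hδpos : 0 < δ := lt_min hr hr'
  -- `u` and `v` play the role of real and imaginary parts: `x = (u + i v, star u + i star v)`.
  -- Replacing the coefficients `(1, i)` by real `(t, τ)` gives an anti-diagonal point, so the two
  -- coefficients are complexified one after the other. Discs of radius 2 contain both `1` and `i`.
  let u : A × A → A := fun x => (2⁻¹ : ℂ) • (x.1 + star x.2)
  let v : A × A → A := fun x => (-(2⁻¹ : ℂ) * Complex.I) • (x.1 - star x.2)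
  have hu : Continuous u := by fun_prop
  have hv : Continuous v := by fun_prop
  have small : ∀ {k : A × A → A}, Continuous k → k 0 = 0 →
      ∀ᶠ x in 𝓝 (0 : A × A), ‖k x‖ < δ / 4 := by
    intro k hk hk0
    have : Tendsto (fun x => ‖k x‖) (𝓝 0) (𝓝 0) := by
      have := (hk.norm).tendsto 0
      simpa [hk0] using this
    exact this.eventually_lt_const (by positivity)
  filter_upwards [small hu (by simp [u]), small hv (by simp [v]),
    small hu.star (by simp [u]), small hv.star (by simp [v])] with x h1 h2 h3 h4
  let y : ℂ → ℂ → A := fun t τ => t • u x + τ • v x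
  let y' : ℂ → ℂ → A := fun t τ => t • star (u x) + τ • star (v x)
  have bound : ∀ {a b : A} {t τ : ℂ}, ‖a‖ < δ / 4 → ‖b‖ < δ / 4 → ‖t‖ < 2 → ‖τ‖ < 2 →
      ‖t • a + τ • b‖ < δ := by
    intro a b t τ ha hb ht hτ
    calc ‖t • a + τ • b‖ ≤ ‖t‖ * ‖a‖ + ‖τ‖ * ‖b‖ := by
          simpa only [norm_smul] using norm_add_le (t • a) (τ • b)
      _ ≤ 2 * ‖a‖ + 2 * ‖b‖ := by gcongr
      _ < δ := by linarith
  have hdiff : ∀ {t τ : ℂ}, ‖t‖ < 2 → ‖τ‖ < 2 → DifferentiableAt ℂ F (y t τ, y' t τ) := by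
    intro t τ ht hτ
    refine hFr _ ?_
    rw [mem_ball_zero_iff, Prod.norm_def, max_lt_iff]
    exact ⟨(bound h1 h2 ht hτ).trans_le (min_le_left _ _),
      (bound h3 h4 ht hτ).trans_le (min_le_left _ _)⟩
  have hreal : ∀ t τ : ℝ, |t| < 2 → |τ| < 2 → F (y t τ, y' t τ) = 0 := by
    intro t τ ht hτ
    have : y' t τ = star (y t τ) := by simp [y, y']
    rw [this]
    refine hr0 _ ?_
    rw [mem_ball_zero_iff]
    exact (bound h1 h2 (by simpa using ht) (by simpa using hτ)).trans_le (min_le_right _ _)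
  have hone : ∀ (t : ℂ) (τ : ℝ), ‖t‖ < 2 → |τ| < 2 → F (y t τ, y' t τ) = 0 := by
    intro t τ ht hτ
    refine eq_zero_of_real_eq_zero (f := fun t => F (y t τ, y' t τ)) (R := 2) ?_ ?_ ht
    · intro t ht
      refine DifferentiableAt.differentiableWithinAt ?_
      refine DifferentiableAt.comp (g := F) t (hdiff (by simpa using ht) (by simpa using hτ)) ?_
      simp only [y, y']
      fun_prop
    · exact fun t ht => hreal t τ ht hτ
  have htwo : F (y 1 Complex.I, y' 1 Complex.I) = 0 := by
    refine eq_zero_of_real_eq_zero (f := fun τ => F (y 1 τ, y' 1 τ)) (R := 2) ?_ ?_ (by simp)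
    · intro τ hτ
      refine DifferentiableAt.differentiableWithinAt ?_
      refine DifferentiableAt.comp (g := F) τ (hdiff (by simp) (by simpa using hτ)) ?_
      simp only [y, y']
      fun_prop
    · exact fun τ hτ => hone 1 τ (by simp) hτ
  have e1 : y 1 Complex.I = x.1 := by
    simp only [y, u, v, smul_smul, one_mul]
    have : Complex.I * (-2⁻¹ * Complex.I) = 2⁻¹ := by
      linear_combination (-2⁻¹ : ℂ) * Complex.I_mul_I
    rw [this, ← smul_add, add_add_sub_cancel, ← two_smul ℂ, smul_smul]
    norm_num
  have e2 : y' 1 Complex.I = x.2 := by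
    simp only [y', u, v, star_smul, smul_smul, one_mul, star_add, star_sub, star_star]
    have : Complex.I * star (-2⁻¹ * Complex.I) = -2⁻¹ := by
      simp only [star_mul', star_neg, star_inv₀, RCLike.star_def, Complex.conj_I, map_ofNat]
      linear_combination (2⁻¹ : ℂ) * Complex.I_mul_I
    rw [this, neg_smul, ← sub_eq_add_neg]
    simp only [star_inv₀, star_ofNat]
    rw [← smul_sub, add_sub_sub_cancel, ← two_smul ℂ, smul_smul]
    norm_num
  rw [e1, e2] at htwo
  exact htwo

end CRModel

/-! ### Holomorphic matrix functions and entrywise conjugation -/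

namespace CRModel

section Entrywise

variable {E : Type*} [NormedAddCommGroup E] [NormedSpace ℂ E] {k : ℕ}

/-- All entries of the matrix function `X` are complex differentiable at `x`. -/
def EntrywiseDifferentiableAt (X : E → Matrix (Fin k) (Fin k) ℂ) (x : E) : Prop :=
  ∀ i j, DifferentiableAt ℂ (fun y => X y i j) x

namespace EntrywiseDifferentiableAt

variable {X Y : E → Matrix (Fin k) (Fin k) ℂ} {x : E}

theorem const (A : Matrix (Fin k) (Fin k) ℂ) : EntrywiseDifferentiableAt (fun _ : E => A) x :=
  fun _ _ => differentiableAt_const _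

theorem mul (hX : EntrywiseDifferentiableAt X x) (hY : EntrywiseDifferentiableAt Y x) :
    EntrywiseDifferentiableAt (fun y => X y * Y y) x := by
  intro i j
  simp only [Matrix.mul_apply]
  exact DifferentiableAt.fun_sum fun l _ => (hX i l).mul (hY l j)

theorem add (hX : EntrywiseDifferentiableAt X x) (hY : EntrywiseDifferentiableAt Y x) :
    EntrywiseDifferentiableAt (fun y => X y + Y y) x :=
  fun i j => (hX i j).add (hY i j)

theorem sub (hX : EntrywiseDifferentiableAt X x) (hY : EntrywiseDifferentiableAt Y x) :
    EntrywiseDifferentiableAt (fun y => X y - Y y) x :=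
  fun i j => (hX i j).sub (hY i j)

theorem const_smul (c : ℂ) (hX : EntrywiseDifferentiableAt X x) :
    EntrywiseDifferentiableAt (fun y => c • X y) x :=
  fun i j => (hX i j).const_smul c

theorem det (hX : EntrywiseDifferentiableAt X x) :
    DifferentiableAt ℂ (fun y => (X y).det) x := by
  simp only [Matrix.det_apply]
  refine DifferentiableAt.fun_sum fun σ _ => DifferentiableAt.const_smul ?_ _
  exact (HasFDerivAt.finsetProd fun i _ => (hX (σ i) i).hasFDerivAt).differentiableAt

theorem adjugate (hX : EntrywiseDifferentiableAt X x) :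
    EntrywiseDifferentiableAt (fun y => (X y).adjugate) x := by
  intro i j
  simp only [Matrix.adjugate_apply]
  refine det fun a b => ?_
  by_cases h : a = j
  · subst h; simp
  · simpa [Matrix.updateRow_ne h] using hX a b

theorem inv (hX : EntrywiseDifferentiableAt X x) (h : (X x).det ≠ 0) :
    EntrywiseDifferentiableAt (fun y => (X y)⁻¹) x := by
  intro i j
  simp only [Matrix.inv_def, Ring.inverse_eq_inv', Matrix.smul_apply, smul_eq_mul]
  exact (hX.det.inv h).mul (hX.adjugate i j)

theorem comp {F : Type*} [NormedAddCommGroup F] [NormedSpace ℂ F] {f : F → E} {y : F}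
    (hX : EntrywiseDifferentiableAt X (f y)) (hf : DifferentiableAt ℂ f y) :
    EntrywiseDifferentiableAt (fun y => X (f y)) y :=
  fun i j => (hX i j).comp y hf

theorem continuousAt (hX : EntrywiseDifferentiableAt X x) : ContinuousAt X x :=
  continuousAt_pi.2 fun i => continuousAt_pi.2 fun j => (hX i j).continuousAt

/-- The two conjugations cancel. This makes the polarized matrices holomorphic in the second
variable too. -/
theorem conj_star [StarAddMonoid E] [StarModule ℂ E] [ContinuousStar E]
    (hX : EntrywiseDifferentiableAt X (star x)) :
    EntrywiseDifferentiableAt (fun y => conj (X (star y))) x :=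
  fun i j => star_star x ▸ (hX i j).star_star

theorem dotProduct_mulVec {f g : E → Fin k → ℂ} (hX : EntrywiseDifferentiableAt X x)
    (hf : DifferentiableAt ℂ f x) (hg : DifferentiableAt ℂ g x) :
    DifferentiableAt ℂ (fun y => f y ⬝ᵥ (X y *ᵥ g y)) x := by
  simp only [dotProduct, mulVec]
  rw [differentiableAt_pi] at hf hg
  exact DifferentiableAt.fun_sum fun i _ => (hf i).mul
    (DifferentiableAt.fun_sum fun j _ => (hX i j).mul (hg j))

end EntrywiseDifferentiableAt

/-- The determinant of `1 - X` is `1` at `x`, hence nonzero nearby, and the inverse is the adjugate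
over the determinant. -/
theorem eventually_entrywiseDifferentiableAt_one_sub_inv
    {X : E → Matrix (Fin k) (Fin k) ℂ} {x : E}
    (hX : ∀ᶠ y in 𝓝 x, EntrywiseDifferentiableAt X y) (h0 : X x = 0) :
    ∀ᶠ y in 𝓝 x, EntrywiseDifferentiableAt (fun y => (1 - X y)⁻¹) y := by
  have hdet : ∀ᶠ y in 𝓝 x, (1 - X y).det ≠ 0 := by
    have hc : ContinuousAt (fun y => (1 - X y).det) x :=
      ((EntrywiseDifferentiableAt.const 1).sub hX.self_of_nhds).det.continuousAt
    exact hc.eventually_ne (by simp [h0])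
  filter_upwards [hX, hdet] with y hy hy'
  exact ((EntrywiseDifferentiableAt.const 1).sub hy).inv hy'

end Entrywise

section Conj

variable {k : ℕ} (A B : Matrix (Fin k) (Fin k) ℂ)

@[simp] theorem conj_conj : conj (conj A) = A := by
  ext i j; simp [conj]

@[simp] theorem conj_zero : conj (0 : Matrix (Fin k) (Fin k) ℂ) = 0 := by
  ext i j; simp [conj]

theorem conj_mul : conj (A * B) = conj A * conj B := by
  ext i j; simp [conj, Matrix.mul_apply]

theorem conj_transpose : conj Aᵀ = (conj A)ᵀ := rfl

theorem conjTranspose_eq_transpose_conj : Aᴴ = (conj A)ᵀ := rfl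

theorem conj_smul (c : ℂ) : conj (c • A) = star c • conj A := by
  ext i j; simp [conj]

theorem star_mulVec_eq (v : Fin k → ℂ) : star (A *ᵥ v) = conj A *ᵥ star v := by
  ext i; simp [conj, mulVec, dotProduct]

theorem star_dotProduct_mulVec_eq (u v : Fin k → ℂ) :
    star (u ⬝ᵥ (A *ᵥ v)) = star u ⬝ᵥ (conj A *ᵥ star v) := by
  simp [conj, mulVec, dotProduct]

theorem dotProduct_mulVec_comm (u v : Fin k → ℂ) :
    u ⬝ᵥ (A *ᵥ v) = v ⬝ᵥ (Aᵀ *ᵥ u) := by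
  rw [Matrix.mulVec_transpose, dotProduct_comm v, Matrix.dotProduct_mulVec]

end Conj

/-! ### Polarized defining equation -/

variable {s m : ℕ}

/-- The polarization of `hermitianPart`: the variables `ζ` and `ζ̄` are independent. -/
noncomputable def polarHermitian (H : Matrix (Fin s) (Fin s) ℂ)
    (S : (Fin m → ℂ) → Matrix (Fin s) (Fin s) ℂ) (ζ η : Fin m → ℂ) : Matrix (Fin s) (Fin s) ℂ :=
  (1 / 2 : ℂ) • (H * (1 - conj (S (star η)) * Hᵀ * S ζ * H)⁻¹
    + (1 - H * conj (S (star η)) * Hᵀ * S ζ)⁻¹ * H)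

/-- The polarization of `symmetricPart`. -/
noncomputable def polarSymmetric (H : Matrix (Fin s) (Fin s) ℂ)
    (S : (Fin m → ℂ) → Matrix (Fin s) (Fin s) ℂ) (ζ η : Fin m → ℂ) : Matrix (Fin s) (Fin s) ℂ :=
  Hᵀ * (1 - S ζ * H * conj (S (star η)) * Hᵀ)⁻¹ * S ζ * H

/-- The polarization of the right-hand side of the equation of the model. -/
noncomputable def polar (H : Matrix (Fin s) (Fin s) ℂ)
    (S : (Fin m → ℂ) → Matrix (Fin s) (Fin s) ℂ) (p q : Ambient s m) : ℂ :=
  p.2.1 ⬝ᵥ (polarHermitian H S p.2.2 q.2.2 *ᵥ q.2.1)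
    + (1 / 2) * (q.2.1 ⬝ᵥ (polarSymmetric H S p.2.2 q.2.2 *ᵥ q.2.1))
    + (1 / 2) * (p.2.1 ⬝ᵥ (conj (polarSymmetric H S (star q.2.2) (star p.2.2)) *ᵥ p.2.1))

section

variable {H : Matrix (Fin s) (Fin s) ℂ} {S : (Fin m → ℂ) → Matrix (Fin s) (Fin s) ℂ}

theorem mem_model_iff (p : Ambient s m) :
    p ∈ model H S ↔ (p.1.re : ℂ) = polar H S p (star p) := by
  have key : ∀ c : ℂ, (c.re : ℂ) = (1 / 2) * c + (1 / 2) * star c := by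
    intro c
    rw [Complex.re_eq_add_conj]
    simp only [RCLike.star_def]
    ring
  simp only [model, hypersurface, Set.mem_ofPred_eq, polar, hermitianPart, polarHermitian,
    Prod.fst_star, Prod.snd_star, star_star]
  rw [key (star p.2.1 ⬝ᵥ _), star_dotProduct_mulVec_eq, star_star, ← add_assoc]
  simp only [symmetricPart, polarSymmetric, star_star]

/-- Conjugate transposition exchanges the two summands, which is why the definition averages them.
-/
theorem IsModelData.conjTranspose_polarHermitian (h : IsModelData H S) {ζ : Fin m → ℂ}
    (hζ : (S ζ).IsSymm) :
    (polarHermitian H S ζ (star ζ))ᴴ = polarHermitian H S ζ (star ζ) := by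
  have hH : Hᴴ = H := h.isHermitian
  have hS : (S ζ)ᴴ = conj (S ζ) := by rw [conjTranspose_eq_transpose_conj, ← conj_transpose, hζ]
  have hS' : (conj (S ζ))ᴴ = S ζ := by rw [← hS, conjTranspose_conjTranspose]
  have hHT : (Hᵀ)ᴴ = Hᵀ := by
    rw [conjTranspose_eq_transpose_conj, conj_transpose, ← conjTranspose_eq_transpose_conj, hH]
  simp only [polarHermitian, star_star, conjTranspose_smul, conjTranspose_add, conjTranspose_mul,
    conjTranspose_nonsing_inv, conjTranspose_sub, conjTranspose_one, hH, hS, hS', hHT]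
  rw [add_comm]
  simp [Matrix.mul_assoc]

/-- The Hermitian term is its own conjugate and the two quadratic terms are exchanged. Reality is
what lets `w` be adjusted to land on the model in `IsGermMap.polarize`. -/
theorem IsModelData.star_polar (h : IsModelData H S) {p : Ambient s m} (hp : (S p.2.2).IsSymm) :
    star (polar H S p (star p)) = polar H S p (star p) := by
  have hc : (conj (polarHermitian H S p.2.2 (star p.2.2)))ᵀ
      = polarHermitian H S p.2.2 (star p.2.2) := h.conjTranspose_polarHermitian hp
  simp only [polar, Prod.fst_star, Prod.snd_star, star_star, star_add, star_mul',
    star_dotProduct_mulVec_eq, conj_conj]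
  rw [dotProduct_mulVec_comm (conj _), hc]
  simp only [star_div₀, star_one, star_ofNat]
  ring

theorem IsModelData.eventually_differentiableAt (h : IsModelData H S) :
    ∀ᶠ ζ in 𝓝 (0 : Fin m → ℂ), EntrywiseDifferentiableAt S ζ := by
  have : ∀ i j, ∀ᶠ ζ in 𝓝 (0 : Fin m → ℂ), DifferentiableAt ℂ (fun ζ => S ζ i j) ζ :=
    fun i j => (h.holomorphic i j).eventually_analyticAt.mono fun ζ hζ => hζ.differentiableAt
  simpa only [EntrywiseDifferentiableAt, eventually_all] using this

theorem tendsto_star_zero {E : Type*} [NormedAddCommGroup E] [StarAddMonoid E]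
    [ContinuousStar E] : Tendsto (star : E → E) (𝓝 0) (𝓝 0) :=
  continuous_star.tendsto' 0 0 (star_zero _)

theorem IsModelData.eventually_differentiableAt_polarHermitian (h : IsModelData H S) :
    ∀ᶠ x in 𝓝 (0 : (Fin m → ℂ) × (Fin m → ℂ)),
      EntrywiseDifferentiableAt (fun x => polarHermitian H S x.1 x.2) x := by
  have h1 : ∀ᶠ x in 𝓝 (0 : (Fin m → ℂ) × (Fin m → ℂ)),
      EntrywiseDifferentiableAt (fun x => S x.1) x :=
    (continuous_fst.tendsto' 0 0 rfl).eventually h.eventually_differentiableAt |>.mono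
      fun x hx => hx.comp differentiableAt_fst
  have h2 : ∀ᶠ x in 𝓝 (0 : (Fin m → ℂ) × (Fin m → ℂ)),
      EntrywiseDifferentiableAt (fun x => conj (S (star x.2))) x :=
    ((tendsto_star_zero.comp (continuous_snd.tendsto' 0 0 rfl)).eventually
      h.eventually_differentiableAt).mono fun x hx =>
        (EntrywiseDifferentiableAt.conj_star hx).comp differentiableAt_snd
  have c : ∀ {x : (Fin m → ℂ) × (Fin m → ℂ)} (A : Matrix (Fin s) (Fin s) ℂ),
    EntrywiseDifferentiableAt (fun _ => A) x := fun A => .const A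
  have h3 := eventually_entrywiseDifferentiableAt_one_sub_inv (x := 0)
    (X := fun x : (Fin m → ℂ) × (Fin m → ℂ) => conj (S (star x.2)) * Hᵀ * S x.1 * H)
    (by filter_upwards [h1, h2] with x h1 h2 using ((h2.mul (c _)).mul h1).mul (c _))
    (by simp [h.vanishing])
  have h4 := eventually_entrywiseDifferentiableAt_one_sub_inv (x := 0)
    (X := fun x : (Fin m → ℂ) × (Fin m → ℂ) => H * conj (S (star x.2)) * Hᵀ * S x.1)
    (by filter_upwards [h1, h2] with x h1 h2 using (((c _).mul h2).mul (c _)).mul h1)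
    (by simp [h.vanishing])
  filter_upwards [h3, h4] with x h3 h4
  exact (((c _).mul h3).add (h4.mul (c _))).const_smul _

theorem IsModelData.eventually_differentiableAt_polarSymmetric (h : IsModelData H S) :
    ∀ᶠ x in 𝓝 (0 : (Fin m → ℂ) × (Fin m → ℂ)),
      EntrywiseDifferentiableAt (fun x => polarSymmetric H S x.1 x.2) x := by
  have h1 : ∀ᶠ x in 𝓝 (0 : (Fin m → ℂ) × (Fin m → ℂ)),
      EntrywiseDifferentiableAt (fun x => S x.1) x :=
    (continuous_fst.tendsto' 0 0 rfl).eventually h.eventually_differentiableAt |>.mono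
      fun x hx => hx.comp differentiableAt_fst
  have h2 : ∀ᶠ x in 𝓝 (0 : (Fin m → ℂ) × (Fin m → ℂ)),
      EntrywiseDifferentiableAt (fun x => conj (S (star x.2))) x :=
    ((tendsto_star_zero.comp (continuous_snd.tendsto' 0 0 rfl)).eventually
      h.eventually_differentiableAt).mono fun x hx =>
        (EntrywiseDifferentiableAt.conj_star hx).comp differentiableAt_snd
  have c : ∀ {x : (Fin m → ℂ) × (Fin m → ℂ)} (A : Matrix (Fin s) (Fin s) ℂ),
    EntrywiseDifferentiableAt (fun _ => A) x := fun A => .const A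
  have h3 := eventually_entrywiseDifferentiableAt_one_sub_inv (x := 0)
    (X := fun x : (Fin m → ℂ) × (Fin m → ℂ) => S x.1 * H * conj (S (star x.2)) * Hᵀ)
    (by filter_upwards [h1, h2] with x h1 h2 using ((h1.mul (c _)).mul h2).mul (c _))
    (by simp [h.vanishing])
  filter_upwards [h1, h3] with x h1 h3
  exact (((c _).mul h3).mul h1).mul (c _)

theorem IsModelData.eventually_differentiableAt_conj_polarSymmetric (h : IsModelData H S) :
    ∀ᶠ x in 𝓝 (0 : (Fin m → ℂ) × (Fin m → ℂ)),
      EntrywiseDifferentiableAt (fun x => conj (polarSymmetric H S (star x.2) (star x.1))) x := by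
  have ht : Tendsto (fun x : (Fin m → ℂ) × (Fin m → ℂ) => star x.swap) (𝓝 0) (𝓝 0) :=
    tendsto_star_zero.comp (continuous_swap.tendsto' 0 0 rfl)
  filter_upwards [ht.eventually h.eventually_differentiableAt_polarSymmetric] with x hx
  exact (EntrywiseDifferentiableAt.conj_star (x := x.swap) hx).comp
    (f := fun x : (Fin m → ℂ) × (Fin m → ℂ) => (x.2, x.1)) (by fun_prop)

/-- Since `polar` is quadratic in the `z`-components and independent of `w`, only the `ζ`-components
need be small. Rescaled limits later use points whose `z`-components are not small. -/
theorem IsModelData.eventually_differentiableAt_polar (h : IsModelData H S) :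
    ∀ᶠ y in 𝓝 (0 : (Fin m → ℂ) × (Fin m → ℂ)), ∀ x : Ambient s m × Ambient s m,
      (x.1.2.2, x.2.2.2) = y →
        DifferentiableAt ℂ (fun x : Ambient s m × Ambient s m => polar H S x.1 x.2) x := by
  let π : Ambient s m × Ambient s m → (Fin m → ℂ) × (Fin m → ℂ) := fun x => (x.1.2.2, x.2.2.2)
  filter_upwards [h.eventually_differentiableAt_polarHermitian,
    h.eventually_differentiableAt_polarSymmetric,
    h.eventually_differentiableAt_conj_polarSymmetric] with y h1 h2 h3 x hx
  subst hx
  have dπ : DifferentiableAt ℂ π x := by fun_prop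
  have k1 := (h1.comp (f := π) dπ).dotProduct_mulVec (f := fun x => x.1.2.1)
    (g := fun x => x.2.2.1) (by fun_prop) (by fun_prop)
  have k2 := (h2.comp (f := π) dπ).dotProduct_mulVec (f := fun x => x.2.2.1)
    (g := fun x => x.2.2.1) (by fun_prop) (by fun_prop)
  have k3 := (h3.comp (f := π) dπ).dotProduct_mulVec (f := fun x => x.1.2.1)
    (g := fun x => x.1.2.1) (by fun_prop) (by fun_prop)
  exact (k1.add (k2.const_mul _)).add (k3.const_mul _)

theorem IsModelData.eventually_differentiableAt_polar_nhds_zero (h : IsModelData H S) :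
    ∀ᶠ x in 𝓝 (0 : Ambient s m × Ambient s m),
      DifferentiableAt ℂ (fun x : Ambient s m × Ambient s m => polar H S x.1 x.2) x := by
  let π : Ambient s m × Ambient s m → (Fin m → ℂ) × (Fin m → ℂ) := fun x => (x.1.2.2, x.2.2.2)
  have hπ : Tendsto π (𝓝 0) (𝓝 0) :=
    (show Continuous π by fun_prop).tendsto' 0 0 rfl
  exact (hπ.eventually h.eventually_differentiableAt_polar).mono fun x hx => hx x rfl

/-- Homogeneity of weight two; the `w`-components are arbitrary on both sides because `polar`
ignores them. -/
theorem polar_smul (c w w' ω ω' : ℂ) (z ξ : Fin s → ℂ) (ζ η : Fin m → ℂ) :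
    polar H S (w, c • z, ζ) (ω, c • ξ, η) = c ^ 2 * polar H S (w', z, ζ) (ω', ξ, η) := by
  simp only [polar, mulVec_smul, dotProduct_smul, smul_dotProduct, smul_eq_mul]
  ring

theorem IsModelData.polarHermitian_zero_right (h : IsModelData H S) (ζ : Fin m → ℂ) :
    polarHermitian H S ζ 0 = H := by
  simp only [polarHermitian, star_zero, h.vanishing, conj_zero]
  simp [← two_smul ℂ, smul_smul]

theorem IsModelData.polarSymmetric_zero_right (h : IsModelData H S) (ζ : Fin m → ℂ) :
    polarSymmetric H S ζ 0 = Hᵀ * S ζ * H := by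
  simp [polarSymmetric, h.vanishing]

theorem IsModelData.polarSymmetric_zero_left (h : IsModelData H S) (η : Fin m → ℂ) :
    polarSymmetric H S 0 η = 0 := by
  simp [polarSymmetric, h.vanishing]

theorem IsModelData.polar_zero_right (h : IsModelData H S) (p : Ambient s m) (ω : ℂ)
    (ξ : Fin s → ℂ) :
    polar H S p (ω, ξ, 0) = p.2.1 ⬝ᵥ (H *ᵥ ξ) + (1 / 2) * (ξ ⬝ᵥ ((Hᵀ * S p.2.2 * H) *ᵥ ξ)) := by
  simp [polar, h.polarHermitian_zero_right, h.polarSymmetric_zero_right,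
    h.polarSymmetric_zero_left]

end

end CRModel

/-! ### Slopes along weighted dilations -/

namespace CRModel

section Slopes

variable {E : Type*} [NormedAddCommGroup E] [NormedSpace ℂ E] {s m : ℕ}

/-- The point `(0, 0, ζ)`. -/
def leaf (s : ℕ) {m : ℕ} (ζ : Fin m → ℂ) : Ambient s m := (0, 0, ζ)

theorem leaf_zero : leaf s (0 : Fin m → ℂ) = 0 := rfl

theorem continuous_leaf : Continuous (leaf s : (Fin m → ℂ) → Ambient s m) := by
  unfold leaf; fun_prop

theorem tendsto_leaf : Tendsto (leaf s : (Fin m → ℂ) → Ambient s m) (𝓝 0) (𝓝 0) :=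
  continuous_leaf.tendsto' 0 0 rfl

theorem tendsto_slope_comp {φ : Ambient s m → Ambient s m} {c : ℝ → Ambient s m}
    {v : Ambient s m} (hφ : DifferentiableAt ℂ φ (c 0)) (hc : HasDerivAt c v 0) :
    Tendsto (fun t : ℝ => (t : ℂ)⁻¹ • (φ (c t) - φ (c 0))) (𝓝[≠] 0)
      (𝓝 (fderiv ℂ φ (c 0) v)) := by
  have := ((hφ.hasFDerivAt.restrictScalars ℝ).comp_hasDerivAt (0 : ℝ) hc).tendsto_slope_zero
  simp only [zero_add, Function.comp_apply] at this
  refine this.congr fun t => ?_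
  rw [← Complex.ofReal_inv, Complex.coe_smul]

/-- The point `(t² w, t z, ζ)`. -/
noncomputable def dilate (ζ : Fin m → ℂ) (w : ℂ) (z : Fin s → ℂ) (t : ℝ) : Ambient s m :=
  ((t : ℂ) ^ 2 * w, (t : ℂ) • z, ζ)

theorem hasDerivAt_dilate (ζ : Fin m → ℂ) (w : ℂ) (z : Fin s → ℂ) :
    HasDerivAt (dilate ζ w z) (0, z, 0) 0 := by
  have h1 : HasDerivAt (fun t : ℝ => (t : ℂ)) 1 (0 : ℝ) := Complex.ofRealCLM.hasDerivAt
  have h2 : HasDerivAt (fun t : ℝ => (t : ℂ) ^ 2 * w) 0 (0 : ℝ) := by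
    simpa using (h1.fun_pow 2).mul_const w
  have h3 : HasDerivAt (fun t : ℝ => (t : ℂ) • z) z (0 : ℝ) := by
    simpa using h1.smul_const z
  exact h2.prodMk (h3.prodMk (hasDerivAt_const _ _))

theorem dilate_zero (ζ : Fin m → ℂ) (w : ℂ) (z : Fin s → ℂ) : dilate ζ w z 0 = leaf s ζ := by
  simp [dilate, leaf]

theorem tendsto_dilate (ζ : Fin m → ℂ) (w : ℂ) (z : Fin s → ℂ) :
    Tendsto (dilate ζ w z) (𝓝[≠] 0) (𝓝 (leaf s ζ)) := by
  rw [← dilate_zero ζ w z]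
  exact (hasDerivAt_dilate ζ w z).continuousAt.tendsto.mono_left nhdsWithin_le_nhds

theorem star_dilate (ζ : Fin m → ℂ) (w : ℂ) (z : Fin s → ℂ) (t : ℝ) :
    star (dilate ζ w z t) = dilate (star ζ) (star w) (star z) t := by
  ext <;> simp [dilate]

/-- The dilated points for `w` and for `0` share their `z`-component and differ by `t² w` in the
first direction; at the latter the first component of `φ` vanishes. Strict differentiability applied
to this pair yields the limit without any second-order expansion. -/
theorem tendsto_fst_dilate {φ : Ambient s m → Ambient s m} {ζ : Fin m → ℂ}
    (hφ : AnalyticAt ℂ φ (leaf s ζ))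
    (h : ∀ᶠ p in 𝓝 (leaf s ζ), p.1 = 0 → (φ p).1 = 0) (w : ℂ) (z : Fin s → ℂ) :
    Tendsto (fun t : ℝ => ((t : ℂ) ^ 2)⁻¹ * (φ (dilate ζ w z t)).1) (𝓝[≠] 0)
      (𝓝 ((fderiv ℂ φ (leaf s ζ) (1, 0, 0)).1 * w)) := by
  have hs := hφ.hasStrictFDerivAt.isLittleO
  have hk : Tendsto (fun t => (dilate ζ w z t, dilate ζ 0 z t)) (𝓝[≠] 0)
      (𝓝 (leaf s ζ, leaf s ζ)) := (tendsto_dilate ζ w z).prodMk_nhds (tendsto_dilate ζ 0 z)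
  have ho := hs.comp_tendsto hk
  have hsub : ∀ t, dilate ζ w z t - dilate ζ 0 z t
      = ((t : ℂ) ^ 2) • (w • ((1, 0, 0) : Ambient s m)) := by
    intro t
    ext <;> simp [dilate]
  simp only [Function.comp_def, hsub] at ho
  have hO : (fun t : ℝ => ((t : ℂ) ^ 2) • (w • ((1, 0, 0) : Ambient s m)))
      =O[𝓝[≠] 0] fun t : ℝ => (t : ℂ) ^ 2 :=
    Asymptotics.IsBigO.of_bound ‖w • ((1, 0, 0) : Ambient s m)‖
      (Eventually.of_forall fun t => by rw [norm_smul, mul_comm])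
  have ho' := ho.trans_isBigO hO
  have ho2 := ho'.tendsto_inv_smul_nhds_zero
  have ho3 := ((continuous_fst.tendsto' (0 : Ambient s m) 0 rfl).comp ho2).add_const
    ((fderiv ℂ φ (leaf s ζ) (1, 0, 0)).1 * w)
  rw [zero_add] at ho3
  refine ho3.congr' ?_
  filter_upwards [(tendsto_dilate ζ 0 z).eventually h, self_mem_nhdsWithin] with t ht ht0
  have htc : (t : ℂ) ≠ 0 := by simpa using ht0
  have h0 : (φ (dilate ζ 0 z t)).1 = 0 := ht (by simp [dilate])
  simp only [Function.comp_apply, map_smul, Prod.smul_fst, Prod.fst_sub, h0, smul_eq_mul]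
  field_simp
  ring

end Slopes

/-! ### Complexification of germ maps and the Segre variety of the origin -/

variable {s m : ℕ} {H H' : Matrix (Fin s) (Fin s) ℂ}
  {S S' : (Fin m → ℂ) → Matrix (Fin s) (Fin s) ℂ}

/-- `φ` is holomorphic at `0`, fixes `0` and maps the germ of `M` at `0` into `M'`. -/
structure IsGermMap (φ : Ambient s m → Ambient s m) (M M' : Set (Ambient s m)) : Prop where
  analyticAt : AnalyticAt ℂ φ 0
  map_zero : φ 0 = 0
  maps : ∀ᶠ p in 𝓝 0, p ∈ M → φ p ∈ M'

theorem polar_congr {p p' q q' : Ambient s m} (hp : p.2 = p'.2) (hq : q.2 = q'.2) :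
    polar H S p q = polar H S p' q' := by
  simp only [polar, hp, hq]

namespace IsGermMap

variable {φ ψ : Ambient s m → Ambient s m}

theorem tendsto (hφ : IsGermMap φ (model H S) (model H' S')) : Tendsto φ (𝓝 0) (𝓝 0) := by
  simpa only [hφ.map_zero] using hφ.analyticAt.continuousAt.tendsto

theorem tendsto_star_star (hφ : IsGermMap φ (model H S) (model H' S')) :
    Tendsto (fun q => star (φ (star q))) (𝓝 0) (𝓝 0) :=
  tendsto_star_zero.comp (hφ.tendsto.comp tendsto_star_zero)

/-- The complexification of `φ` maps the complexification of the source to that of the target. -/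
theorem polarize (h : IsModelData H S) (h' : IsModelData H' S')
    (hφ : IsGermMap φ (model H S) (model H' S')) :
    ∀ᶠ x in 𝓝 (0 : Ambient s m × Ambient s m), x.1.1 + x.2.1 = 2 * polar H S x.1 x.2 →
      (φ x.1).1 + (star (φ (star x.2))).1
        = 2 * polar H' S' (φ x.1) (star (φ (star x.2))) := by
  let P : Ambient s m × Ambient s m → ℂ := fun x => polar H S x.1 x.2
  -- `R` is a holomorphic retraction onto the complexified model: it keeps the difference of the
  -- `w`-components and replaces their sum by `2 * P`. Hence `F` is defined on a full neighbourhood,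
  -- and its vanishing at fixed points of `R` is the claim.
  let R : Ambient s m × Ambient s m → Ambient s m × Ambient s m := fun x =>
    ((P x + (1 / 2) * (x.1.1 - x.2.1), x.1.2), (P x - (1 / 2) * (x.1.1 - x.2.1), x.2.2))
  let Φ : Ambient s m × Ambient s m → Ambient s m × Ambient s m := fun x =>
    (φ x.1, star (φ (star x.2)))
  let F : Ambient s m × Ambient s m → ℂ := fun x =>
    (Φ (R x)).1.1 + (Φ (R x)).2.1 - 2 * polar H' S' (Φ (R x)).1 (Φ (R x)).2
  have hP := h.eventually_differentiableAt_polar_nhds_zero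
  have hR : ∀ᶠ x in 𝓝 0, DifferentiableAt ℂ R x := by
    filter_upwards [hP] with x hx
    have hx' : DifferentiableAt ℂ P x := hx
    fun_prop
  have hR0 : R 0 = 0 := by
    have : P 0 = 0 := by simp [P, polar]
    simp [R, this]
  have hRt : Tendsto R (𝓝 0) (𝓝 0) := by
    simpa only [hR0] using hR.self_of_nhds.continuousAt.tendsto
  have hφd : ∀ᶠ p in 𝓝 (0 : Ambient s m), DifferentiableAt ℂ φ p :=
    hφ.analyticAt.eventually_analyticAt.mono fun p hp => hp.differentiableAt
  have hΦ : ∀ᶠ x in 𝓝 (0 : Ambient s m × Ambient s m), DifferentiableAt ℂ Φ x := by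
    filter_upwards [(continuous_fst.tendsto' (0 : Ambient s m × Ambient s m) 0 rfl).eventually hφd,
      (tendsto_star_zero.comp (continuous_snd.tendsto' (0 : Ambient s m × Ambient s m) 0
        rfl)).eventually hφd] with x h1 h2
    have h3 : DifferentiableAt ℂ (star ∘ φ ∘ star) x.2 := star_star x.2 ▸ h2.star_star
    exact (h1.comp x differentiableAt_fst).prodMk (h3.comp x differentiableAt_snd)
  have hΦt : Tendsto Φ (𝓝 0) (𝓝 0) :=
    (hφ.tendsto.comp (continuous_fst.tendsto' (0 : Ambient s m × Ambient s m) 0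
      rfl)).prodMk_nhds (hφ.tendsto_star_star.comp
        (continuous_snd.tendsto' (0 : Ambient s m × Ambient s m) 0 rfl))
  have hF : ∀ᶠ x in 𝓝 0, DifferentiableAt ℂ F x := by
    filter_upwards [hR, hRt.eventually hΦ, (hΦt.comp hRt).eventually
      h'.eventually_differentiableAt_polar_nhds_zero] with x h1 h2 h3
    have h4 : DifferentiableAt ℂ (fun x => Φ (R x)) x := h2.comp x h1
    have h5 := h3.comp x h4
    exact (h4.fst.fst.add h4.snd.fst).sub (h5.const_mul 2)
  have hanti : ∀ᶠ p in 𝓝 (0 : Ambient s m), F (p, star p) = 0 := by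
    have hsym : ∀ᶠ p in 𝓝 (0 : Ambient s m), (S p.2.2).IsSymm :=
      ((show Continuous fun p : Ambient s m => p.2.2 by fun_prop).tendsto' 0 0 rfl).eventually
        h.symmetric
    have hr : Tendsto (fun p : Ambient s m => (R (p, star p)).1) (𝓝 0) (𝓝 0) := by
      have : Tendsto (fun p : Ambient s m => (p, star p)) (𝓝 0) (𝓝 0) :=
        tendsto_id.prodMk_nhds tendsto_star_zero
      exact (continuous_fst.tendsto' (0 : Ambient s m × Ambient s m) 0 rfl).comp (hRt.comp this)
    filter_upwards [hsym, hr.eventually hφ.maps] with p h1 h2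
    have hreal : star (P (p, star p)) = P (p, star p) := h.star_polar h1
    have hstar : (R (p, star p)).2 = star (R (p, star p)).1 := by
      refine Prod.ext ?_ rfl
      simp only [R, Prod.fst_star, star_add, star_mul', star_sub, star_star, hreal, star_div₀,
        star_one, star_ofNat]
      ring
    have re_eq : ∀ c : ℂ, c + star c = 2 * (c.re : ℂ) := by
      intro c
      rw [Complex.re_eq_add_conj]
      simp only [RCLike.star_def]
      ring
    have hmem : (R (p, star p)).1 ∈ model H S := by
      rw [mem_model_iff]
      have e : polar H S (R (p, star p)).1 (star (R (p, star p)).1) = P (p, star p) :=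
        polar_congr rfl rfl
      rw [e]
      have := re_eq (R (p, star p)).1.1
      have h3 : star (R (p, star p)).1.1 = (R (p, star p)).2.1 := by rw [hstar]; rfl
      rw [h3] at this
      simp only [R] at this ⊢
      linear_combination (-1 / 2 : ℂ) * this
    have := (mem_model_iff _).1 (h2 hmem)
    simp only [F, Φ, hstar, star_star, ← this]
    rw [Prod.fst_star, re_eq, sub_self]
  filter_upwards [eventually_eq_zero_of_antidiagonal hF hanti] with x hx hx'
  have hRx : R x = x := by
    refine Prod.ext (Prod.ext ?_ rfl) (Prod.ext ?_ rfl)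
    · simp only [R, P]; linear_combination (-1 / 2 : ℂ) * hx'
    · simp only [R, P]; linear_combination (-1 / 2 : ℂ) * hx'
  simp only [F, hRx, Φ] at hx
  exact sub_eq_zero.1 hx

/-- `φ` preserves the Segre variety `{w = 0}` of the origin. -/
theorem fst_eq_zero (h : IsModelData H S) (h' : IsModelData H' S')
    (hφ : IsGermMap φ (model H S) (model H' S')) :
    ∀ᶠ p in 𝓝 (0 : Ambient s m), p.1 = 0 → (φ p).1 = 0 := by
  have ht : Tendsto (fun p : Ambient s m => (p, (0 : Ambient s m))) (𝓝 0) (𝓝 0) :=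
    (show Continuous fun p : Ambient s m => (p, (0 : Ambient s m)) by fun_prop).tendsto' 0 0 rfl
  filter_upwards [ht.eventually (hφ.polarize h h')] with p hp h0
  have e : ∀ {H : Matrix (Fin s) (Fin s) ℂ} {S} (_ : IsModelData H S) (p : Ambient s m),
      polar H S p 0 = 0 := by
    intro H S h p
    exact (h.polar_zero_right p 0 0).trans (by simp)
  simpa [e h, e h', hφ.map_zero, h0] using hp

/-- As `{w = 0}` is preserved, the differential at `0` preserves its tangent hyperplane. -/
theorem fderiv_fst (h : IsModelData H S) (h' : IsModelData H' S')
    (hφ : IsGermMap φ (model H S) (model H' S')) (v : Ambient s m) :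
    (fderiv ℂ φ 0 v).1 = (fderiv ℂ φ 0 (1, 0, 0)).1 * v.1 := by
  have hker : ∀ v : Ambient s m, v.1 = 0 → (fderiv ℂ φ 0 v).1 = 0 := by
    intro v hv
    have hc : HasDerivAt (fun t : ℝ => t • v) v 0 := by
      simpa using (hasDerivAt_id (0 : ℝ)).smul_const v
    have hd : DifferentiableAt ℂ φ ((0 : ℝ) • v) := by
      rw [zero_smul]; exact hφ.analyticAt.differentiableAt
    have h1 := (continuous_fst.tendsto _).comp (tendsto_slope_comp hd hc)
    rw [zero_smul] at h1
    refine tendsto_nhds_unique h1 (tendsto_const_nhds.congr' ?_)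
    have ht : Tendsto (fun t : ℝ => t • v) (𝓝[≠] 0) (𝓝 0) :=
      ((show Continuous fun t : ℝ => t • v by fun_prop).tendsto' 0 0
        (zero_smul _ _)).mono_left nhdsWithin_le_nhds
    filter_upwards [ht.eventually (hφ.fst_eq_zero h h')] with t ht
    simp [ht (by simp [hv]), hφ.map_zero]
  have : v = v.1 • ((1, 0, 0) : Ambient s m) + (0, v.2) := by ext <;> simp
  conv_lhs => rw [this]
  rw [map_add, map_smul, Prod.fst_add, hker (0, v.2) rfl, add_zero, Prod.smul_fst, smul_eq_mul,
    mul_comm]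

/-- The `w`-rows of both differentials have a single nonzero entry at most, so by the chain rule
these entries multiply to `1`. -/
theorem fderiv_fst_ne_zero (h : IsModelData H S) (h' : IsModelData H' S')
    (hφ : IsGermMap φ (model H S) (model H' S')) (hψ : IsGermMap ψ (model H' S') (model H S))
    (hinv : ∀ᶠ p in 𝓝 0, ψ (φ p) = p) : (fderiv ℂ φ 0 (1, 0, 0)).1 ≠ 0 := by
  intro h0
  have hd : HasFDerivAt (fun p => ψ (φ p)) ((fderiv ℂ ψ (φ 0)).comp (fderiv ℂ φ 0)) 0 := by
    refine HasFDerivAt.comp (g := ψ) (0 : Ambient s m) ?_ hφ.analyticAt.differentiableAt.hasFDerivAt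
    rw [hφ.map_zero]
    exact hψ.analyticAt.differentiableAt.hasFDerivAt
  have hid : HasFDerivAt (fun p => ψ (φ p)) (ContinuousLinearMap.id ℂ (Ambient s m)) 0 :=
    (hasFDerivAt_id _).congr_of_eventuallyEq hinv
  have := congrArg (fun L : Ambient s m →L[ℂ] Ambient s m => (L (1, 0, 0)).1) (hd.unique hid)
  simp [hφ.map_zero, hψ.fderiv_fst h' h (fderiv ℂ φ 0 (1, 0, 0)), h0] at this

end IsGermMap

end CRModel

/-! ### The invariant leaf and the weight-two equation -/

namespace CRModel

variable {s m : ℕ} {H H' : Matrix (Fin s) (Fin s) ℂ}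
  {S S' : (Fin m → ℂ) → Matrix (Fin s) (Fin s) ℂ}

/-- `polar` is continuous at `(p, q)` when the `ζ`-components of `p` and `q` are small. -/
theorem IsModelData.eventually_continuousAt_polar (h : IsModelData H S) :
    ∀ᶠ ζ in 𝓝 (0 : Fin m → ℂ), ∀ p q : Ambient s m, p.2.2 = ζ → q.2.2 = 0 →
      ContinuousAt (fun x : Ambient s m × Ambient s m => polar H S x.1 x.2) (p, q) := by
  have ht : Tendsto (fun ζ : Fin m → ℂ => (ζ, (0 : Fin m → ℂ))) (𝓝 0) (𝓝 0) :=
    (show Continuous fun ζ : Fin m → ℂ => (ζ, (0 : Fin m → ℂ)) by fun_prop).tendsto' 0 0 rfl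
  filter_upwards [ht.eventually h.eventually_differentiableAt_polar] with ζ hζ p q hp hq
  exact (hζ (p, q) (by rw [← hp, ← hq])).continuousAt

theorem tendsto_ofReal_punctured : Tendsto (fun t : ℝ => (t : ℂ)) (𝓝[≠] 0) (𝓝 0) :=
  (Complex.continuous_ofReal.tendsto' 0 0 (by simp)).mono_left nhdsWithin_le_nhds

namespace IsGermMap

variable {φ ψ : Ambient s m → Ambient s m}

/-- `φ` maps the leaf `{w = 0, z = 0}` through the origin to the corresponding leaf. -/
theorem map_leaf (h : IsModelData H S) (h' : IsModelData H' S')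
    (hφ : IsGermMap φ (model H S) (model H' S')) (hψ : IsGermMap ψ (model H' S') (model H S))
    (hψφ : ∀ᶠ p in 𝓝 0, ψ (φ p) = p) (hφψ : ∀ᶠ p in 𝓝 0, φ (ψ p) = p) :
    ∀ᶠ ζ in 𝓝 (0 : Fin m → ℂ), φ (leaf s ζ) = leaf s (φ (leaf s ζ)).2.2 := by
  have hcurve : Tendsto (fun ζ : Fin m → ℂ => (φ (leaf s ζ), (0 : Ambient s m))) (𝓝 0) (𝓝 0) :=
    (hφ.tendsto.comp tendsto_leaf).prodMk_nhds tendsto_const_nhds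
  filter_upwards [tendsto_leaf.eventually (hφ.fst_eq_zero h h'), tendsto_leaf.eventually hψφ,
    hcurve.eventually (hψ.polarize h' h).eventually_nhds, h.eventually_continuousAt_polar]
    with ζ h1 h2 h3 h4
  have hw : (φ (leaf s ζ)).1 = 0 := h1 rfl
  set p₀ := φ (leaf s ζ) with hp₀
  suffices hz : p₀.2.1 = 0 from Prod.ext hw (Prod.ext hz rfl)
  -- The Segre variety of `p₀` has velocity `(b, ξ, 0)` at `0` with `b = 2 p₀.zᵀ H' ξ`, whereas that
  -- of a leaf point is tangent to `{w = 0}` there. Transport by `ψ` forces `b = 0`.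
  have key : ∀ ξ : Fin s → ℂ, p₀.2.1 ⬝ᵥ (H' *ᵥ ξ) = 0 := by
    intro ξ
    set b := 2 * (p₀.2.1 ⬝ᵥ (H' *ᵥ ξ)) with hb
    set d := ξ ⬝ᵥ ((H'ᵀ * S' p₀.2.2 * H') *ᵥ ξ) with hd
    -- The coefficients `b` and `d` make `(p₀, q t)` satisfy the complexified equation exactly.
    let q : ℝ → Ambient s m := fun t => ((t : ℂ) * b + (t : ℂ) ^ 2 * d, (t : ℂ) • ξ, 0)
    have hq0 : q 0 = 0 := by ext <;> simp [q]
    have hqd : HasDerivAt q (b, ξ, 0) 0 := by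
      have k1 : HasDerivAt (fun t : ℝ => (t : ℂ)) 1 (0 : ℝ) := Complex.ofRealCLM.hasDerivAt
      have k2 : HasDerivAt (fun t : ℝ => (t : ℂ) * b + (t : ℂ) ^ 2 * d) b (0 : ℝ) := by
        simpa using (k1.mul_const b).fun_add ((k1.fun_pow 2).mul_const d)
      have k3 : HasDerivAt (fun t : ℝ => (t : ℂ) • ξ) ξ (0 : ℝ) := by
        simpa using k1.smul_const ξ
      exact k2.prodMk (k3.prodMk (hasDerivAt_const _ _))
    have hqt : Tendsto q (𝓝[≠] 0) (𝓝 0) := by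
      rw [← hq0]; exact hqd.continuousAt.tendsto.mono_left nhdsWithin_le_nhds
    have hqs : HasDerivAt (fun t => star (q t)) (star (b, ξ, 0)) 0 := hqd.star
    have hψ0 : DifferentiableAt ℂ ψ (star (q 0)) := by
      rw [hq0, star_zero]; exact hψ.analyticAt.differentiableAt
    let r : ℝ → Ambient s m := fun t => star (ψ (star (q t)))
    have hrt : Tendsto r (𝓝[≠] 0) (𝓝 0) := hψ.tendsto_star_star.comp hqt
    have hr : Tendsto (fun t : ℝ => (t : ℂ)⁻¹ • r t) (𝓝[≠] 0)
        (𝓝 (star (fderiv ℂ ψ 0 (star (b, ξ, 0))))) := by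
      have := (tendsto_slope_comp hψ0 hqs).star
      rw [hq0, star_zero, hψ.map_zero] at this
      refine this.congr fun t => ?_
      simp [r]
    have heq : ∀ᶠ t in 𝓝[≠] (0 : ℝ), (r t).1 = 2 * polar H S (leaf s ζ) (r t) := by
      have ht : Tendsto (fun t => (p₀, q t)) (𝓝[≠] 0) (𝓝 (p₀, 0)) :=
        tendsto_const_nhds.prodMk_nhds hqt
      filter_upwards [ht.eventually h3] with t ht
      have hmem : p₀.1 + (q t).1 = 2 * polar H' S' p₀ (q t) := by
        rw [h'.polar_zero_right]
        simp only [q, hw, mulVec_smul, dotProduct_smul, smul_dotProduct, smul_eq_mul]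
        rw [hb, hd]
        ring
      have := ht hmem
      rw [h2] at this
      simpa [leaf, r] using this
    -- The `z`-component of the leaf point is `0`, so homogeneity leaves a factor `t` after division
    -- by `t`, and the slope of the first component tends to `0`.
    have heq' : ∀ᶠ t : ℝ in 𝓝[≠] 0, ((t : ℂ)⁻¹ • r t).1
        = 2 * ((t : ℂ) * polar H S (leaf s ζ) (0, ((t : ℂ)⁻¹ • r t).2.1, (r t).2.2)) := by
      filter_upwards [heq, self_mem_nhdsWithin] with t ht ht0
      have htc : (t : ℂ) ≠ 0 := by simpa using ht0
      have := polar_smul (H := H) (S := S) (t : ℂ) 0 0 (r t).1 0 0 ((t : ℂ)⁻¹ • r t).2.1 ζ (r t).2.2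
      rw [Prod.smul_snd, Prod.smul_fst, smul_inv_smul₀ htc, smul_zero] at this
      rw [Prod.smul_fst, ht, smul_eq_mul]
      change (t : ℂ)⁻¹ * (2 * polar H S (0, 0, ζ) ((r t).1, (r t).2.1, (r t).2.2)) = _
      rw [this]
      simp only [leaf, Prod.smul_snd, Prod.smul_fst]
      field_simp
    have hlim1 := (continuous_fst.tendsto _).comp hr
    have hlim2 : Tendsto (fun t : ℝ => 2 * ((t : ℂ) * polar H S (leaf s ζ)
        (0, ((t : ℂ)⁻¹ • r t).2.1, (r t).2.2))) (𝓝[≠] 0) (𝓝 0) := by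
      have hcont := h4 (leaf s ζ) (0, (star (fderiv ℂ ψ 0 (star (b, ξ, 0)))).2.1, 0) rfl rfl
      have hpt : Tendsto (fun t : ℝ => (leaf s ζ,
          ((0, ((t : ℂ)⁻¹ • r t).2.1, (r t).2.2) : Ambient s m))) (𝓝[≠] 0)
          (𝓝 (leaf s ζ, (0, (star (fderiv ℂ ψ 0 (star (b, ξ, 0)))).2.1, 0))) := by
        refine tendsto_const_nhds.prodMk_nhds (tendsto_const_nhds.prodMk_nhds
          (Tendsto.prodMk_nhds ?_ ?_))
        · exact ((show Continuous fun p : Ambient s m => p.2.1 by fun_prop).tendsto _).comp hr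
        · exact ((show Continuous fun p : Ambient s m => p.2.2 by fun_prop).tendsto' 0 0 rfl).comp
            hrt
      simpa using (tendsto_ofReal_punctured.mul (hcont.tendsto.comp hpt)).const_mul 2
    have hzero := tendsto_nhds_unique (hlim1.congr' heq') hlim2
    rw [Prod.fst_star, hψ.fderiv_fst h' h, Prod.fst_star, star_mul', star_star] at hzero
    have ha := hψ.fderiv_fst_ne_zero h' h hφ hφψ
    have hb0 : b = 0 := (mul_eq_zero.1 hzero).resolve_left (star_ne_zero.2 ha)
    simpa [hb] using hb0
  have hvec : p₀.2.1 ᵥ* H' = 0 := by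
    refine dotProduct_eq_zero _ fun ξ => ?_
    rw [← dotProduct_mulVec]
    exact key ξ
  have hdet : IsUnit H'.det := (Matrix.isUnit_iff_isUnit_det _).1 h'.nondegenerate
  have := congrArg (fun v => v ᵥ* H'⁻¹) hvec
  simpa [Matrix.vecMul_vecMul, Matrix.mul_nonsing_inv _ hdet] using this

/-- The terms of weight two of the equation satisfied by `φ` along the leaf. -/
theorem weight_two (h : IsModelData H S) (h' : IsModelData H' S')
    (hφ : IsGermMap φ (model H S) (model H' S'))
    (hleaf : ∀ᶠ ζ in 𝓝 (0 : Fin m → ℂ), φ (leaf s ζ) = leaf s (φ (leaf s ζ)).2.2) :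
    ∀ᶠ ζ in 𝓝 (0 : Fin m → ℂ), ∀ (w ω : ℂ) (z ξ : Fin s → ℂ),
      w + ω = 2 * (z ⬝ᵥ (H *ᵥ ξ)) + ξ ⬝ᵥ ((Hᵀ * S ζ * H) *ᵥ ξ) →
      (fderiv ℂ φ (leaf s ζ) (1, 0, 0)).1 * w + star (fderiv ℂ φ 0 (1, 0, 0)).1 * ω
        = 2 * ((fderiv ℂ φ (leaf s ζ) (0, z, 0)).2.1 ⬝ᵥ
            (H' *ᵥ star (fderiv ℂ φ 0 (0, star ξ, 0)).2.1))
          + star (fderiv ℂ φ 0 (0, star ξ, 0)).2.1 ⬝ᵥ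
            ((H'ᵀ * S' (φ (leaf s ζ)).2.2 * H') *ᵥ star (fderiv ℂ φ 0 (0, star ξ, 0)).2.1) := by
  have hcurve : Tendsto (fun ζ : Fin m → ℂ => (leaf s ζ, (0 : Ambient s m))) (𝓝 0) (𝓝 0) :=
    tendsto_leaf.prodMk_nhds tendsto_const_nhds
  have hg : Tendsto (fun ζ : Fin m → ℂ => (φ (leaf s ζ)).2.2) (𝓝 0) (𝓝 0) :=
    ((show Continuous fun p : Ambient s m => p.2.2 by fun_prop).tendsto' 0 0 rfl).comp
      (hφ.tendsto.comp tendsto_leaf)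
  have hfst := hφ.fst_eq_zero h h'
  filter_upwards [hleaf, tendsto_leaf.eventually hfst.eventually_nhds,
    tendsto_leaf.eventually hφ.analyticAt.eventually_analyticAt,
    hcurve.eventually (hφ.polarize h h').eventually_nhds,
    hg.eventually h'.eventually_continuousAt_polar] with ζ h1 h2 h3 h4 h5 w ω z ξ hwω
  -- The hypothesis on `(w, ω, z, ξ)` is homogeneous of weight two, so the dilated pair stays on the
  -- complexified source.
  let p := dilate ζ w z
  let q := dilate (0 : Fin m → ℂ) ω ξ
  have hp : Tendsto p (𝓝[≠] 0) (𝓝 (leaf s ζ)) := tendsto_dilate ζ w z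
  have hq : Tendsto q (𝓝[≠] 0) (𝓝 0) := tendsto_dilate 0 ω ξ
  have hsq : ∀ t, star (q t) = dilate (0 : Fin m → ℂ) (star ω) (star ξ) t := by
    intro t
    simp only [q, star_dilate, star_zero]
  let r : ℝ → Ambient s m := fun t => star (φ (star (q t)))
  have hrt : Tendsto r (𝓝[≠] 0) (𝓝 0) := hφ.tendsto_star_star.comp hq
  have heq : ∀ᶠ t in 𝓝[≠] (0 : ℝ), (φ (p t)).1 + (r t).1 = 2 * polar H' S' (φ (p t)) (r t) := by
    filter_upwards [(hp.prodMk_nhds hq).eventually h4] with t ht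
    refine ht ?_
    simp only [p, q, dilate]
    rw [h.polar_zero_right]
    simp only [mulVec_smul, dotProduct_smul, smul_dotProduct, smul_eq_mul]
    linear_combination (t : ℂ) ^ 2 * hwω
  have l1 : Tendsto (fun t : ℝ => ((t : ℂ) ^ 2)⁻¹ * (φ (p t)).1) (𝓝[≠] 0)
      (𝓝 ((fderiv ℂ φ (leaf s ζ) (1, 0, 0)).1 * w)) := tendsto_fst_dilate h3 h2 w z
  have l2 : Tendsto (fun t : ℝ => ((t : ℂ) ^ 2)⁻¹ * (r t).1) (𝓝[≠] 0)
      (𝓝 (star (fderiv ℂ φ 0 (1, 0, 0)).1 * ω)) := by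
    have := (tendsto_fst_dilate (ζ := (0 : Fin m → ℂ)) hφ.analyticAt hfst (star ω)
      (star ξ)).star
    rw [star_mul', star_star] at this
    refine this.congr fun t => ?_
    simp [r, hsq]
  -- Invariance of the leaf enters here: the `z`-component of `φ` vanishes at `leaf s ζ`, so
  -- dividing it by `t` gives a derivative.
  have l3 : Tendsto (fun t : ℝ => (t : ℂ)⁻¹ • (φ (p t)).2.1) (𝓝[≠] 0)
      (𝓝 (fderiv ℂ φ (leaf s ζ) (0, z, 0)).2.1) := by
    have := tendsto_slope_comp (c := p) (φ := φ)
      (by simp only [p, dilate_zero]; exact h3.differentiableAt) (hasDerivAt_dilate ζ w z)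
    simp only [p, dilate_zero] at this
    refine (((show Continuous fun p : Ambient s m => p.2.1 by fun_prop).tendsto _).comp
      this).congr fun t => ?_
    rw [h1]
    simp [p, leaf]
  have l4 : Tendsto (fun t : ℝ => (t : ℂ)⁻¹ • (r t).2.1) (𝓝[≠] 0)
      (𝓝 (star (fderiv ℂ φ 0 (0, star ξ, 0)).2.1)) := by
    have := tendsto_slope_comp (c := fun t => star (q t)) (φ := φ) (v := (0, star ξ, 0))
      (by simp only [hsq, dilate_zero]; exact hφ.analyticAt.differentiableAt)
      (by simpa only [hsq] using hasDerivAt_dilate 0 (star ω) (star ξ))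
    simp only [hsq, dilate_zero, leaf_zero, hφ.map_zero, sub_zero] at this
    refine (((show Continuous fun p : Ambient s m => p.2.1 by fun_prop).tendsto _).comp
      this).star.congr fun t => ?_
    simp [r, hsq]
  have heq' : ∀ᶠ t : ℝ in 𝓝[≠] 0, ((t : ℂ) ^ 2)⁻¹ * (φ (p t)).1 + ((t : ℂ) ^ 2)⁻¹ * (r t).1
      = 2 * polar H' S' (0, (t : ℂ)⁻¹ • (φ (p t)).2.1, (φ (p t)).2.2)
        (0, (t : ℂ)⁻¹ • (r t).2.1, (r t).2.2) := by
    filter_upwards [heq] with t ht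
    rw [polar_smul (t : ℂ)⁻¹ 0 (φ (p t)).1 0 (r t).1, ← mul_add, ht, inv_pow]
    ring
  have hB := h5 (0, (fderiv ℂ φ (leaf s ζ) (0, z, 0)).2.1, (φ (leaf s ζ)).2.2)
    (0, star (fderiv ℂ φ 0 (0, star ξ, 0)).2.1, 0) rfl rfl
  have hφp : Tendsto (fun t => (φ (p t)).2.2) (𝓝[≠] 0) (𝓝 (φ (leaf s ζ)).2.2) :=
    ((show Continuous fun p : Ambient s m => p.2.2 by fun_prop).tendsto _).comp
      (h3.continuousAt.tendsto.comp hp)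
  have hr2 : Tendsto (fun t => (r t).2.2) (𝓝[≠] 0) (𝓝 0) :=
    ((show Continuous fun p : Ambient s m => p.2.2 by fun_prop).tendsto' 0 0 rfl).comp hrt
  have l5 := (hB.tendsto.comp ((tendsto_const_nhds.prodMk_nhds (l3.prodMk_nhds hφp)).prodMk_nhds
    (tendsto_const_nhds.prodMk_nhds (l4.prodMk_nhds hr2)))).const_mul 2
  have := tendsto_nhds_unique ((l1.add l2).congr' heq') l5
  rw [this, h'.polar_zero_right]
  ring

end IsGermMap

end CRModel

/-! ### From the weight-two equation to the equivalence of pairs -/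

namespace CRModel

section MatrixForms

variable {k : ℕ} {A B : Matrix (Fin k) (Fin k) ℂ}

theorem eq_of_dotProduct_mulVec (h : ∀ u v : Fin k → ℂ, u ⬝ᵥ (A *ᵥ v) = u ⬝ᵥ (B *ᵥ v)) :
    A = B := by
  ext i j
  simpa using h (Pi.single i 1) (Pi.single j 1)

theorem eq_of_dotProduct_mulVec_self (hA : A.IsSymm) (hB : B.IsSymm)
    (h : ∀ v : Fin k → ℂ, v ⬝ᵥ (A *ᵥ v) = v ⬝ᵥ (B *ᵥ v)) : A = B := by
  refine eq_of_dotProduct_mulVec fun u v => ?_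
  have huv := h (u + v)
  simp only [mulVec_add, dotProduct_add, add_dotProduct] at huv
  rw [dotProduct_mulVec_comm A v u, dotProduct_mulVec_comm B v u, hA.eq, hB.eq] at huv
  linear_combination (1 / 2 : ℂ) * (huv - h u - h v)

theorem mulVec_dotProduct_mulVec (P X Q : Matrix (Fin k) (Fin k) ℂ) (u v : Fin k → ℂ) :
    (P *ᵥ u) ⬝ᵥ (X *ᵥ (Q *ᵥ v)) = u ⬝ᵥ ((Pᵀ * X * Q) *ᵥ v) := by
  rw [← mulVec_mulVec, ← mulVec_mulVec, dotProduct_mulVec u Pᵀ, vecMul_transpose]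

theorem isSymm_transpose_mul_mul (hA : A.IsSymm) (X : Matrix (Fin k) (Fin k) ℂ) :
    (Xᵀ * A * X).IsSymm := by
  simp [Matrix.IsSymm, transpose_mul, hA.eq, Matrix.mul_assoc]

theorem inv_one_sub_mul_mul (h : A * B = 1) (X : Matrix (Fin k) (Fin k) ℂ) :
    (1 - A * X * B)⁻¹ = A * (1 - X)⁻¹ * B := by
  have e : 1 - A * X * B = A * (1 - X) * B := by
    rw [Matrix.mul_sub, Matrix.sub_mul, Matrix.mul_one, h]
  rw [e, Matrix.mul_inv_rev, Matrix.mul_inv_rev, inv_eq_right_inv h, inv_eq_left_inv h,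
    Matrix.mul_assoc]

end MatrixForms

variable {s m : ℕ} {H H' : Matrix (Fin s) (Fin s) ℂ}
  {S S' : (Fin m → ℂ) → Matrix (Fin s) (Fin s) ℂ}

namespace IsGermMap

variable {φ ψ : Ambient s m → Ambient s m}

theorem exists_matrix (h : IsModelData H S) (h' : IsModelData H' S')
    (hφ : IsGermMap φ (model H S) (model H' S')) (hψ : IsGermMap ψ (model H' S') (model H S))
    (hψφ : ∀ᶠ p in 𝓝 0, ψ (φ p) = p) (hφψ : ∀ᶠ p in 𝓝 0, φ (ψ p) = p) :
    ∃ (a : ℂ) (B : Matrix (Fin s) (Fin s) ℂ), a ≠ 0 ∧ star a = a ∧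
      a • H = Bᵀ * H' * conj B ∧ ∀ᶠ ζ in 𝓝 (0 : Fin m → ℂ),
        a • (Hᵀ * S ζ * H)
          = (conj B)ᵀ * (H'ᵀ * S' (φ (leaf s ζ)).2.2 * H') * conj B := by
  have hw := hφ.weight_two h h' (hφ.map_leaf h h' hψ hψφ hφψ)
  set a := (fderiv ℂ φ 0 (1, 0, 0)).1 with ha
  let L : (Fin s → ℂ) →ₗ[ℂ] (Fin s → ℂ) :=
    (LinearMap.fst ℂ _ _ ∘ₗ LinearMap.snd ℂ _ _) ∘ₗ (fderiv ℂ φ 0).toLinearMap ∘ₗ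
      LinearMap.inr ℂ ℂ _ ∘ₗ LinearMap.inl ℂ (Fin s → ℂ) (Fin m → ℂ)
  set B := LinearMap.toMatrix' L with hB
  have hL : ∀ z : Fin s → ℂ, (fderiv ℂ φ 0 (0, z, 0)).2.1 = B *ᵥ z := by
    intro z
    rw [hB, LinearMap.toMatrix'_mulVec]
    rfl
  have hLs : ∀ ξ : Fin s → ℂ, star (fderiv ℂ φ 0 (0, star ξ, 0)).2.1 = conj B *ᵥ ξ := by
    intro ξ
    rw [hL, star_mulVec_eq, star_star]
  simp only [hLs] at hw
  have h0 := hw.self_of_nhds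
  have hreal : star a = a := by
    -- At `ζ = 0` and `z = ξ = 0` the weight-two equation reduces to `a - star a = 0`.
    have := h0 1 (-1) 0 0 (by simp)
    simp only [leaf_zero, mulVec_zero, dotProduct_zero] at this
    linear_combination -this
  refine ⟨a, B, hφ.fderiv_fst_ne_zero h h' hψ hψφ, hreal, ?_, ?_⟩
  · refine eq_of_dotProduct_mulVec fun z ξ => ?_
    -- At `ζ = 0` only the Hermitian terms survive.
    have := h0 0 (2 * (z ⬝ᵥ (H *ᵥ ξ))) z ξ (by simp [h.vanishing])
    simp only [leaf_zero, hφ.map_zero, hL, Prod.snd_zero, h'.vanishing] at this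
    rw [← mulVec_dotProduct_mulVec, smul_mulVec, dotProduct_smul, smul_eq_mul]
    simp only [← ha, hreal] at this
    simp only [mul_zero, zero_add, Matrix.zero_mul, zero_mulVec, dotProduct_zero, add_zero] at this
    linear_combination (1 / 2 : ℂ) * this
  · have hg : Tendsto (fun ζ : Fin m → ℂ => (φ (leaf s ζ)).2.2) (𝓝 0) (𝓝 0) :=
      ((show Continuous fun p : Ambient s m => p.2.2 by fun_prop).tendsto' 0 0 rfl).comp
        (hφ.tendsto.comp tendsto_leaf)
    filter_upwards [hw, h.symmetric, hg.eventually h'.symmetric] with ζ hζ hS hS'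
    refine eq_of_dotProduct_mulVec_self ?_
      (isSymm_transpose_mul_mul (isSymm_transpose_mul_mul hS' _) _) fun ξ => ?_
    · exact (isSymm_transpose_mul_mul hS _).smul a
    -- Taking `w = 0` and `z = 0` eliminates the derivatives of `φ` at `leaf s ζ`; only those at `0`
    -- remain, so `B` does not depend on `ζ`.
    · have := hζ 0 (ξ ⬝ᵥ ((Hᵀ * S ζ * H) *ᵥ ξ)) 0 ξ (by simp)
      have e : fderiv ℂ φ (leaf s ζ) (0, 0, 0) = 0 := ContinuousLinearMap.map_zero _
      rw [← mulVec_dotProduct_mulVec, smul_mulVec, dotProduct_smul, smul_eq_mul]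
      simpa [e, hreal, ← ha] using this

/-- With `c² = a⁻¹` and `U = c B`, the factor `a` in the relation for `S` is absorbed exactly, while
in the relation for `H` the real number `c c̄ a` has square `1`, which is the source of the sign. -/
theorem exists_normalized_matrix (h : IsModelData H S) (h' : IsModelData H' S')
    (hφ : IsGermMap φ (model H S) (model H' S')) (hψ : IsGermMap ψ (model H' S') (model H S))
    (hψφ : ∀ᶠ p in 𝓝 0, ψ (φ p) = p) (hφψ : ∀ᶠ p in 𝓝 0, φ (ψ p) = p) :
    ∃ U : GL (Fin s) ℂ,
      (H = U.1ᵀ * H' * conj U.1 ∨ H = -(U.1ᵀ * H' * conj U.1)) ∧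
      ∀ᶠ ζ in 𝓝 (0 : Fin m → ℂ), S ζ = U.1⁻¹ * S' (φ (leaf s ζ)).2.2 * (U.1⁻¹)ᵀ := by
  obtain ⟨a, B, ha, hreal, hH, hS⟩ := hφ.exists_matrix h h' hψ hψφ hφψ
  obtain ⟨c, hc⟩ := IsAlgClosed.exists_pow_nat_eq a⁻¹ two_pos
  have hc0 : c ≠ 0 := by
    rintro rfl
    exact inv_ne_zero ha (by simpa using hc.symm)
  have hHdet : IsUnit H.det := (Matrix.isUnit_iff_isUnit_det _).1 h.nondegenerate
  have hBdet : IsUnit B.det := by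
    have h1 := congrArg Matrix.det hH
    rw [det_smul, det_mul, det_mul, det_transpose] at h1
    refine isUnit_iff_ne_zero.2 fun h0 => ?_
    rw [h0, zero_mul, zero_mul] at h1
    exact mul_ne_zero (pow_ne_zero _ ha) hHdet.ne_zero h1
  have hcB : IsUnit (c • B) := by
    rw [Matrix.isUnit_iff_isUnit_det, det_smul]
    exact (isUnit_iff_ne_zero.2 (pow_ne_zero _ hc0)).mul hBdet
  refine ⟨hcB.unit, ?_, ?_⟩
  · have hsq : (c * star c * a) ^ 2 = 1 := by
      have e : star c ^ 2 = a⁻¹ := by rw [← star_pow, hc, star_inv₀, hreal]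
      rw [mul_pow, mul_pow, e, hc]
      field_simp
    have hU : (c • B)ᵀ * H' * conj (c • B) = (c * star c * a) • H := by
      rw [conj_smul, transpose_smul, Matrix.smul_mul, Matrix.smul_mul, Matrix.mul_smul, smul_smul,
        ← hH, smul_smul]
    rw [IsUnit.unit_spec, hU]
    rcases mul_self_eq_one_iff.1 ((sq _).symm.trans hsq) with h1 | h1
    · exact Or.inl (by rw [h1, one_smul])
    · exact Or.inr (by rw [h1, neg_one_smul, neg_neg])
  · filter_upwards [hS] with ζ hζ
    rw [IsUnit.unit_spec]
    have hBT : IsUnit (Bᵀ).det := by rwa [det_transpose]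
    have hHT : IsUnit (Hᵀ).det := by rwa [det_transpose]
    -- The relation between `H` and `H'` eliminates `H'` from the relation for `S`.
    have e1 : H' * conj B = a • ((B⁻¹)ᵀ * H) := by
      rw [← Matrix.mul_smul, hH, transpose_nonsing_inv, Matrix.mul_assoc Bᵀ,
        Matrix.nonsing_inv_mul_cancel_left _ _ hBT]
    have e2 : (conj B)ᵀ * H'ᵀ = a • (Hᵀ * B⁻¹) := by
      rw [← transpose_mul, e1, transpose_smul, transpose_mul, transpose_transpose]
    set T := S' (φ (leaf s ζ)).2.2
    have e3 : a • (Hᵀ * S ζ * H) = a • (Hᵀ * (a • (B⁻¹ * T * (B⁻¹)ᵀ)) * H) := by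
      rw [hζ]
      calc (conj B)ᵀ * (H'ᵀ * T * H') * conj B = ((conj B)ᵀ * H'ᵀ) * T * (H' * conj B) := by
            simp only [Matrix.mul_assoc]
        _ = _ := by
            rw [e1, e2]
            simp only [Matrix.smul_mul, Matrix.mul_smul, Matrix.mul_assoc]
    have e4 := smul_right_injective _ ha e3
    have e5 := congrArg (fun X => (Hᵀ)⁻¹ * (X * H⁻¹)) e4
    simp only [Matrix.mul_assoc, Matrix.mul_nonsing_inv _ hHdet, Matrix.mul_one,
      Matrix.nonsing_inv_mul_cancel_left _ _ hHT] at e5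
    have e6 : (c • B)⁻¹ = c⁻¹ • B⁻¹ := by
      refine inv_eq_right_inv ?_
      rw [Matrix.smul_mul, Matrix.mul_smul, smul_smul, mul_inv_cancel₀ hc0, one_smul,
        Matrix.mul_nonsing_inv _ hBdet]
    have e7 : c⁻¹ * c⁻¹ = a := by rw [← mul_inv, ← sq, hc, inv_inv]
    rw [e5, e6, transpose_smul]
    simp only [Matrix.smul_mul, Matrix.mul_smul, smul_smul, e7, Matrix.mul_assoc]

end IsGermMap

/-! ### Local biholomorphisms and restriction to the leaf -/

section LocalBiholomorphism

variable {E : Type*} [NormedAddCommGroup E] [NormedSpace ℂ E]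

theorem IsLocalBiholomorphism.symm {e : OpenPartialHomeomorph E E} (he : IsLocalBiholomorphism e) :
    IsLocalBiholomorphism e.symm where
  mem_source := by
    have := e.map_source he.mem_source
    rwa [he.map_zero] at this
  map_zero := by
    have := e.left_inv he.mem_source
    rwa [he.map_zero] at this
  holomorphic := he.holomorphic_symm
  holomorphic_symm := he.holomorphic

theorem IsLocalBiholomorphism.eventually_left_inv {e : OpenPartialHomeomorph E E}
    (he : IsLocalBiholomorphism e) : ∀ᶠ x in 𝓝 0, e.symm (e x) = x :=
  e.eventually_left_inverse he.mem_source

theorem IsLocalBiholomorphism.tendsto {e : OpenPartialHomeomorph E E}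
    (he : IsLocalBiholomorphism e) : Tendsto e (𝓝 0) (𝓝 0) := by
  simpa only [he.map_zero] using (he.holomorphic 0 he.mem_source).continuousAt.tendsto

theorem eventually_mem_iff_symm {e : OpenPartialHomeomorph E E} {M M' : Set E}
    (he : IsLocalBiholomorphism e) (h : ∀ᶠ p in 𝓝 (0 : E), p ∈ M ↔ e p ∈ M') :
    ∀ᶠ p in 𝓝 (0 : E), p ∈ M' ↔ e.symm p ∈ M := by
  filter_upwards [he.symm.tendsto.eventually h, he.symm.eventually_left_inv] with p h1 h2
  rw [e.symm_symm] at h2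
  rw [h1, h2]

variable {s m : ℕ}

/-- A local biholomorphism that preserves the leaf `{w = 0, z = 0}` restricts to a local
biholomorphism of the leaf. -/
theorem exists_restrict_leaf {e : OpenPartialHomeomorph (Ambient s m) (Ambient s m)}
    (he : IsLocalBiholomorphism e)
    (h1 : ∀ᶠ ζ in 𝓝 (0 : Fin m → ℂ), e (leaf s ζ) = leaf s (e (leaf s ζ)).2.2)
    (h2 : ∀ᶠ ζ in 𝓝 (0 : Fin m → ℂ), e.symm (leaf s ζ) = leaf s (e.symm (leaf s ζ)).2.2) :
    ∃ g : OpenPartialHomeomorph (Fin m → ℂ) (Fin m → ℂ), IsLocalBiholomorphism g ∧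
      ∀ ζ, g ζ = (e (leaf s ζ)).2.2 := by
  have main : ∀ {e : OpenPartialHomeomorph (Ambient s m) (Ambient s m)},
      IsLocalBiholomorphism e →
      (∀ᶠ ζ in 𝓝 (0 : Fin m → ℂ), e (leaf s ζ) = leaf s (e (leaf s ζ)).2.2) →
      ∃ U : Set (Fin m → ℂ), IsOpen U ∧ 0 ∈ U ∧
        (∀ ζ ∈ U, e.symm (leaf s (e (leaf s ζ)).2.2) = leaf s ζ) ∧
        AnalyticOnNhd ℂ (fun ζ => (e (leaf s ζ)).2.2) U := by
    intro e he h
    have hsrc : ∀ᶠ ζ in 𝓝 (0 : Fin m → ℂ), leaf s ζ ∈ e.source :=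
      tendsto_leaf.eventually (e.open_source.mem_nhds he.mem_source)
    obtain ⟨U, hU, hUo, hU0⟩ := eventually_nhds_iff.1 (hsrc.and h)
    refine ⟨U, hUo, hU0, fun ζ hζ => ?_, fun ζ hζ => ?_⟩
    · rw [← (hU ζ hζ).2, e.left_inv (hU ζ hζ).1]
    · have hl : AnalyticAt ℂ (leaf s : (Fin m → ℂ) → Ambient s m) ζ :=
        analyticAt_const.prod (analyticAt_const.prod analyticAt_id)
      have hp : AnalyticAt ℂ (fun p : Ambient s m => p.2.2) (e (leaf s ζ)) :=
        ((ContinuousLinearMap.snd ℂ (Fin s → ℂ) (Fin m → ℂ)).comp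
          (ContinuousLinearMap.snd ℂ ℂ _)).analyticAt _
      exact AnalyticAt.comp (f := e ∘ leaf s) hp ((he.holomorphic _ (hU ζ hζ).1).comp hl)
  obtain ⟨U, hUo, hU0, hUinv, hUan⟩ := main he h1
  obtain ⟨V, hVo, hV0, hVinv, hVan⟩ := main he.symm h2
  rw [e.symm_symm] at hVinv
  have cU : ∀ ζ ∈ U, (e.symm (leaf s (e (leaf s ζ)).2.2)).2.2 = ζ := fun ζ hζ => by
    rw [hUinv ζ hζ]; rfl
  have cV : ∀ ζ ∈ V, (e (leaf s (e.symm (leaf s ζ)).2.2)).2.2 = ζ := fun ζ hζ => by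
    rw [hVinv ζ hζ]; rfl
  let g : OpenPartialHomeomorph (Fin m → ℂ) (Fin m → ℂ) :=
    { toFun := fun ζ => (e (leaf s ζ)).2.2
      invFun := fun ζ => (e.symm (leaf s ζ)).2.2
      source := U ∩ (fun ζ => (e (leaf s ζ)).2.2) ⁻¹' V
      target := V ∩ (fun ζ => (e.symm (leaf s ζ)).2.2) ⁻¹' U
      map_source' := fun ζ hζ => ⟨hζ.2, by
        rw [Set.mem_preimage, cU ζ hζ.1]; exact hζ.1⟩
      map_target' := fun ζ hζ => ⟨hζ.2, by
        rw [Set.mem_preimage, cV ζ hζ.1]; exact hζ.1⟩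
      left_inv' := fun ζ hζ => cU ζ hζ.1
      right_inv' := fun ζ hζ => cV ζ hζ.1
      open_source := hUan.continuousOn.isOpen_inter_preimage hUo hVo
      open_target := hVan.continuousOn.isOpen_inter_preimage hVo hUo
      continuousOn_toFun := hUan.continuousOn.mono Set.inter_subset_left
      continuousOn_invFun := hVan.continuousOn.mono Set.inter_subset_left }
  have g0 : (e (leaf s 0)).2.2 = (0 : Fin m → ℂ) := by rw [leaf_zero, he.map_zero]; rfl
  refine ⟨g, ⟨⟨hU0, ?_⟩, g0, hUan.mono Set.inter_subset_left, hVan.mono Set.inter_subset_left⟩,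
    fun ζ => rfl⟩
  rw [Set.mem_preimage, g0]
  exact hV0

end LocalBiholomorphism

theorem IsLocalBiholomorphism.isGermMap {e : OpenPartialHomeomorph (Ambient s m) (Ambient s m)}
    {M M' : Set (Ambient s m)} (he : IsLocalBiholomorphism e)
    (h : ∀ᶠ p in 𝓝 (0 : Ambient s m), p ∈ M ↔ e p ∈ M') : IsGermMap e M M' where
  analyticAt := he.holomorphic 0 he.mem_source
  map_zero := he.map_zero
  maps := h.mono fun _ hp => hp.1

theorem LocallyEquivalent.exists_pair_equivalence (h : IsModelData H S) (h' : IsModelData H' S')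
    (heq : LocallyEquivalent (model H S) (model H' S')) :
    ∃ (U : GL (Fin s) ℂ) (g : OpenPartialHomeomorph (Fin m → ℂ) (Fin m → ℂ)),
      IsLocalBiholomorphism g ∧
      (H' = U.1ᵀ * H * conj U.1 ∨ H' = -(U.1ᵀ * H * conj U.1)) ∧
      ∀ᶠ ζ in 𝓝 (0 : Fin m → ℂ), S' ζ = U.1⁻¹ * S (g ζ) * (U.1⁻¹)ᵀ := by
  obtain ⟨φ, hφ, hM⟩ := heq
  have k1 := hφ.isGermMap hM
  have k2 := hφ.symm.isGermMap (eventually_mem_iff_symm hφ hM)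
  have i1 := hφ.eventually_left_inv
  have i2 := hφ.symm.eventually_left_inv
  rw [φ.symm_symm] at i2
  -- The normalized relations express the source pair through the target pair, so they are applied
  -- to the inverse map.
  obtain ⟨U, hU, hS⟩ := k2.exists_normalized_matrix h' h k1 i2 i1
  obtain ⟨g, hg, hgφ⟩ := exists_restrict_leaf hφ.symm (k2.map_leaf h' h k1 i2 i1)
    (by rw [φ.symm_symm]; exact k1.map_leaf h h' k2 i1 i2)
  exact ⟨U, g, hg, hU, by simpa only [hgφ] using hS⟩

end CRModel

/-! ### Converse: equivalent pairs give equivalent models -/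

namespace CRModel

variable {s m : ℕ} {H H' : Matrix (Fin s) (Fin s) ℂ}
  {S S' : (Fin m → ℂ) → Matrix (Fin s) (Fin s) ℂ}

theorem conj_mul_conj_eq_one {A B : Matrix (Fin s) (Fin s) ℂ} (h : A * B = 1) :
    conj A * conj B = 1 := by
  rw [← conj_mul, h, conj, Matrix.map_one _ (star_zero _) (star_one _)]

section Transform

variable {U V : Matrix (Fin s) (Fin s) ℂ} {ε : ℂ} {ζ ζ' : Fin m → ℂ}

/-- Each product under an inverse contains `H'` twice, so `ε² = 1` disappears and the product is
merely conjugated; the single outer `H'` contributes `ε`. -/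
theorem hermitianPart_transform (hUV : U * V = 1) (hε : ε * ε = 1)
    (hH : H' = ε • (Uᵀ * H * conj U)) (hS : S' ζ = V * S ζ' * Vᵀ) :
    hermitianPart H' S' ζ = ε • (Uᵀ * hermitianPart H S ζ' * conj U) := by
  have hVU : V * U = 1 := mul_eq_one_comm.1 hUV
  have hcUV := conj_mul_conj_eq_one hUV
  have hcVU := conj_mul_conj_eq_one hVU
  have t : ∀ {A B : Matrix (Fin s) (Fin s) ℂ}, A * B = 1 → ∀ X, Bᵀ * (Aᵀ * X) = X := by
    intro A B h X
    rw [← Matrix.mul_assoc, ← transpose_mul, h, transpose_one, Matrix.one_mul]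
  have c : ∀ {A B : Matrix (Fin s) (Fin s) ℂ}, A * B = 1 → ∀ X, A * (B * X) = X := by
    intro A B h X
    rw [← Matrix.mul_assoc, h, Matrix.one_mul]
  have e1 : conj (S' ζ) * H'ᵀ * S' ζ * H'
      = conj V * (conj (S ζ') * Hᵀ * S ζ' * H) * conj U := by
    rw [hS, hH]
    simp only [conj_mul, conj_transpose, transpose_smul, transpose_mul, transpose_transpose,
      Matrix.smul_mul, Matrix.mul_smul, smul_smul, hε, one_smul, Matrix.mul_assoc, t hcUV, t hUV,
      c hUV]
  have e2 : H' * conj (S' ζ) * H'ᵀ * S' ζ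
      = Uᵀ * (H * conj (S ζ') * Hᵀ * S ζ') * Vᵀ := by
    rw [hS, hH]
    simp only [conj_mul, conj_transpose, transpose_smul, transpose_mul, transpose_transpose,
      Matrix.smul_mul, Matrix.mul_smul, smul_smul, hε, one_smul, Matrix.mul_assoc, t hcUV,
      c hUV, c hcUV]
  have hUVt : Uᵀ * Vᵀ = 1 := by rw [← transpose_mul, hVU, transpose_one]
  rw [hermitianPart, e1, e2, inv_one_sub_mul_mul hcVU, inv_one_sub_mul_mul hUVt, hH, hermitianPart]
  simp only [Matrix.smul_mul, Matrix.mul_smul, Matrix.mul_assoc, Matrix.mul_add, Matrix.add_mul,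
    c hcUV, t hUV, smul_add, smul_comm ε]

/-- Here the outer factors also contain `H'` twice, so no `ε` remains. The scalar `c` in
`mem_model_transform` compensates for this mismatch with the Hermitian part. -/
theorem symmetricPart_transform (hUV : U * V = 1) (hε : ε * ε = 1)
    (hH : H' = ε • (Uᵀ * H * conj U)) (hS : S' ζ = V * S ζ' * Vᵀ) :
    symmetricPart H' S' ζ = (conj U)ᵀ * symmetricPart H S ζ' * conj U := by
  have hVU : V * U = 1 := mul_eq_one_comm.1 hUV
  have hcUV := conj_mul_conj_eq_one hUV
  have t : ∀ {A B : Matrix (Fin s) (Fin s) ℂ}, A * B = 1 → ∀ X, Bᵀ * (Aᵀ * X) = X := by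
    intro A B h X
    rw [← Matrix.mul_assoc, ← transpose_mul, h, transpose_one, Matrix.one_mul]
  have c : ∀ {A B : Matrix (Fin s) (Fin s) ℂ}, A * B = 1 → ∀ X, A * (B * X) = X := by
    intro A B h X
    rw [← Matrix.mul_assoc, h, Matrix.one_mul]
  have e1 : S' ζ * H' * conj (S' ζ) * H'ᵀ
      = V * (S ζ' * H * conj (S ζ') * Hᵀ) * U := by
    rw [hS, hH]
    simp only [conj_mul, conj_transpose, transpose_smul, transpose_mul, transpose_transpose,
      Matrix.smul_mul, Matrix.mul_smul, smul_smul, hε, one_smul, Matrix.mul_assoc, t hcUV, t hUV,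
      c hcUV]
  rw [symmetricPart, e1, inv_one_sub_mul_mul hVU, hH, hS, symmetricPart]
  simp only [transpose_smul, transpose_mul, transpose_transpose, Matrix.smul_mul, Matrix.mul_smul,
    smul_smul, hε, one_smul, Matrix.mul_assoc, c hUV, t hUV]

/-- The linear change of coordinates that realizes an equivalence of pairs. -/
theorem mem_model_transform {c : ℂ} (hUV : U * V = 1) (hε : ε = 1 ∨ ε = -1)
    (hc : c ^ 2 = ε) (hcc : c * star c = 1)
    (hH : H' = ε • (Uᵀ * H * conj U)) (hS : S' ζ = V * S ζ' * Vᵀ) (w : ℂ) (z : Fin s → ℂ) :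
    (w, z, ζ) ∈ model H' S' ↔ (ε * w, c • (U *ᵥ z), ζ') ∈ model H S := by
  have hεε : ε * ε = 1 := by rcases hε with rfl | rfl <;> norm_num
  have hεr : star ε = ε := by rcases hε with rfl | rfl <;> simp
  have hsc : star c * star c = ε := by rw [← sq, ← star_pow, hc, hεr]
  have hre : ∀ x : ℂ, ((ε * x).re : ℂ) = ε * (x.re : ℂ) := by
    intro x
    rcases hε with rfl | rfl <;> simp
  have h1 : z ⬝ᵥ (hermitianPart H' S' ζ *ᵥ star z)
      = ε * ((U *ᵥ z) ⬝ᵥ (hermitianPart H S ζ' *ᵥ star (U *ᵥ z))) := by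
    rw [hermitianPart_transform hUV hεε hH hS, star_mulVec_eq, mulVec_dotProduct_mulVec,
      smul_mulVec, dotProduct_smul, smul_eq_mul]
  have h2 : star z ⬝ᵥ (symmetricPart H' S' ζ *ᵥ star z)
      = star (U *ᵥ z) ⬝ᵥ (symmetricPart H S ζ' *ᵥ star (U *ᵥ z)) := by
    rw [symmetricPart_transform hUV hεε hH hS, star_mulVec_eq, mulVec_dotProduct_mulVec]
  simp only [model, hypersurface, Set.mem_ofPred_eq, star_smul, mulVec_smul, dotProduct_smul,
    smul_dotProduct, smul_eq_mul]
  -- The factor `c c̄ = 1` leaves the Hermitian term unchanged, and `c̄² = ε` supplies the sign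
  -- missing in the symmetric term.
  rw [h1, h2, hre, ← mul_assoc (star c) c, mul_comm (star c) c, hcc, one_mul,
    ← mul_assoc (star c) (star c), hsc, hre]
  constructor
  · intro h
    rw [h]
    linear_combination ((U *ᵥ z) ⬝ᵥ (hermitianPart H S ζ' *ᵥ star (U *ᵥ z))) * hεε
  · intro h
    linear_combination ε * h + ((star (U *ᵥ z) ⬝ᵥ
      (symmetricPart H S ζ' *ᵥ star (U *ᵥ z))).re - (w.re : ℂ)) * hεε

end Transform

theorem isLocalBiholomorphism_prod {E F : Type*} [NormedAddCommGroup E] [NormedSpace ℂ E]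
    [NormedAddCommGroup F] [NormedSpace ℂ F] {e : OpenPartialHomeomorph E E}
    {f : OpenPartialHomeomorph F F} (he : IsLocalBiholomorphism e)
    (hf : IsLocalBiholomorphism f) : IsLocalBiholomorphism (e.prod f) where
  mem_source := ⟨he.mem_source, hf.mem_source⟩
  map_zero := Prod.ext he.map_zero hf.map_zero
  holomorphic := fun x hx => (AnalyticAt.comp (f := Prod.fst) (he.holomorphic x.1 hx.1)
    analyticAt_fst).prod (AnalyticAt.comp (f := Prod.snd) (hf.holomorphic x.2 hx.2) analyticAt_snd)
  holomorphic_symm := fun x hx => (AnalyticAt.comp (f := Prod.fst) (he.holomorphic_symm x.1 hx.1)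
    analyticAt_fst).prod
    (AnalyticAt.comp (f := Prod.snd) (hf.holomorphic_symm x.2 hx.2) analyticAt_snd)

theorem isLocalBiholomorphism_continuousLinearEquiv {E : Type*} [NormedAddCommGroup E]
    [NormedSpace ℂ E] (L : E ≃L[ℂ] E) :
    IsLocalBiholomorphism L.toHomeomorph.toOpenPartialHomeomorph where
  mem_source := Set.mem_univ _
  map_zero := L.map_zero
  holomorphic := fun x _ => L.analyticAt x
  holomorphic_symm := fun x _ => L.symm.analyticAt x

theorem locallyEquivalent_of_pair_equivalence (U : GL (Fin s) ℂ)
    {g : OpenPartialHomeomorph (Fin m → ℂ) (Fin m → ℂ)} (hg : IsLocalBiholomorphism g)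
    (hH : H' = U.1ᵀ * H * conj U.1 ∨ H' = -(U.1ᵀ * H * conj U.1))
    (hS : ∀ᶠ ζ in 𝓝 (0 : Fin m → ℂ), S' ζ = U.1⁻¹ * S (g ζ) * (U.1⁻¹)ᵀ) :
    LocallyEquivalent (model H S) (model H' S') := by
  obtain ⟨ε, c, hε, hc, hcc, hHε⟩ : ∃ ε c : ℂ, (ε = 1 ∨ ε = -1) ∧ c ^ 2 = ε ∧ c * star c = 1 ∧
      H' = ε • (U.1ᵀ * H * conj U.1) := by
    rcases hH with h | h
    · exact ⟨1, 1, Or.inl rfl, by simp, by simp, by rw [h, one_smul]⟩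
    · exact ⟨-1, Complex.I, Or.inr rfl, by simp, by simp, by rw [h, neg_one_smul]⟩
  have hε0 : ε ≠ 0 := by rcases hε with rfl | rfl <;> simp
  have hc0 : c ≠ 0 := by rintro rfl; simp at hcc
  have hUV : U.1 * U.1⁻¹ = 1 :=
    Matrix.mul_nonsing_inv _ ((Matrix.isUnit_iff_isUnit_det _).1 U.isUnit)
  have hVU : U.1⁻¹ * U.1 = 1 := mul_eq_one_comm.1 hUV
  let L₁ : ℂ ≃L[ℂ] ℂ := ContinuousLinearEquiv.unitsEquivAut ℂ (Units.mk0 ε hε0)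
  let L₂ : (Fin s → ℂ) ≃L[ℂ] (Fin s → ℂ) := (LinearEquiv.ofLinearMap
    (c • Matrix.mulVecLin U.1) (c⁻¹ • Matrix.mulVecLin U.1⁻¹)
    (LinearMap.ext fun v => by simp [smul_smul, hc0, hUV])
    (LinearMap.ext fun v => by
      simp [smul_smul, hc0, hVU])).toContinuousLinearEquiv
  let ψ := L₁.toHomeomorph.toOpenPartialHomeomorph.prod
    (L₂.toHomeomorph.toOpenPartialHomeomorph.prod g)
  have hψ : IsLocalBiholomorphism ψ :=
    isLocalBiholomorphism_prod (isLocalBiholomorphism_continuousLinearEquiv L₁)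
      (isLocalBiholomorphism_prod (isLocalBiholomorphism_continuousLinearEquiv L₂) hg)
  -- `ψ` maps the second model to the first, so its inverse is the required equivalence.
  refine ⟨ψ.symm, hψ.symm, eventually_mem_iff_symm hψ ?_⟩
  have hζ : Tendsto (fun p : Ambient s m => p.2.2) (𝓝 0) (𝓝 0) :=
    (show Continuous fun p : Ambient s m => p.2.2 by fun_prop).tendsto' 0 0 rfl
  filter_upwards [hζ.eventually hS] with p hp
  have hψp : ψ p = (ε * p.1, c • (U.1 *ᵥ p.2.1), g p.2.2) := by
    refine Prod.ext ?_ rfl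
    change p.1 * ε = ε * p.1
    exact mul_comm _ _
  rw [hψp]
  exact mem_model_transform hUV hε hc hcc hHε hp p.1 p.2.1

end CRModel

theorem proposition1p6 (s m : ℕ)
    (H H' : Matrix (Fin s) (Fin s) ℂ) (S S' : (Fin m → ℂ) → Matrix (Fin s) (Fin s) ℂ)
    (h : CRModel.IsModelData H S) (h' : CRModel.IsModelData H' S') :
    CRModel.LocallyEquivalent (CRModel.model H S) (CRModel.model H' S') ↔
      ∃ (U : GL (Fin s) ℂ) (g : OpenPartialHomeomorph (Fin m → ℂ) (Fin m → ℂ)),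
        CRModel.IsLocalBiholomorphism g ∧
        (H' = U.1ᵀ * H * CRModel.conj U.1 ∨ H' = -(U.1ᵀ * H * CRModel.conj U.1)) ∧
        ∀ᶠ ζ in 𝓝 (0 : Fin m → ℂ), S' ζ = U.1⁻¹ * S (g ζ) * (U.1⁻¹)ᵀ := by
  refine ⟨fun heq => heq.exists_pair_equivalence h h', ?_⟩
  rintro ⟨U, g, hg, hH, hS⟩
  exact CRModel.locallyEquivalent_of_pair_equivalence U hg hH hS
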